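/- Let $K$ be a field and let $\ell\geq n$ be natural numbers. The nilHecke algebra $\mathscr H_n^{(0)}$ is the unital associative $K$-algebra generated by $\psi_1,\dots,\psi_{n-1},y_1,\dots,y_n$ with relations $\psi_r^2=0$; $\psi_r\psi_k=\psi_k\psi_r$ if $|r-k|>1$; $\psi_r\psi_{r+1}\psi_r=\psi_{r+1}\psi_r\psi_{r+1}$; $y_ry_k=y_ky_r$; $\psi_ry_k=y_k\psi_r$ if $k\neq r,r+1$; $\psi_ry_{r+1}=y_r\psi_r+1$ and $y_{r+1}\psi_r=\psi_ry_r+1$. The cyclotomic nilHecke algebra $\mathscr H_{\ell,n}^{(0)}$ is its quotient by the two-sided ideal generated by $y_1^\ell$ (no further relation if $n=0$); $Z$ denotes the center of $\mathscr H_{\ell,n}^{(0)}$, and $*$ the $K$-algebra anti-automorphism of $\mathscr H_{\ell,n}^{(0)}$ fixing every $\psi_r$ and every $y_k$. For $w$ in the symmetric group $\mathfrak S_n$ put $\psi_w:=\psi_{i_1}\cdots\psi_{i_k}$, where $w=s_{i_1}\cdots s_{i_k}$ is a reduced expression in the simple transpositions $s_i=(i,i+1)$ (the choice is irrelevant). Let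 $w_0$ be the longest element of $\mathfrak S_n$ and, for $z_1,z_2\in\mathfrak S_n$, $$F'_{z_1,z_2}:=\psi_{w_0z_1}^{*}\,\bigl(y_1^{n-1}y_2^{n-2}\cdots y_{n-1}\bigr)\,\psi_{w_0}\,\bigl(y_1^{n-1}y_2^{n-2}\cdots y_{n-1}\bigr)\,\psi_{z_2}.$$ Write $u\succeq w$ if some reduced expression $w=s_{j_1}\cdots s_{j_k}$ has an initial segment with $u=s_{j_1}\cdots s_{j_l}$, $l\leq k$, and $u\succ w$ if moreover $u\neq w$. Let $1=w_1,w_2,\dots,w_{n!}$ be any enumeration of $\mathfrak S_n$ such that $w_i^{-1}\succ w_j^{-1}$ only if $i<j$, and define recursively, for $1\leq i,j\leq n!$, $$\mathfrak f_{w_i,w_j}:=F'_{w_i,w_j}-\sum_{1\leq k<i}\mathfrak f_{w_k,w_k}F'_{w_i,w_j}.$$ Let $E_{i,j}$ $(1\leq i,j\leq n!)$ be the matrix units of $M_{n!\times n!}(K)$. Then the map $$E_{i,j}\otimes z\mapsto \mathfrak f_{w_i,w_j}\,z,\qquad 1\leq i,j\leq n!,\ z\in Z,$$ extends linearly to a well-defined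 $K$-algebra isomorphism from $M_{n!\times n!}(K)\otimes_KZ$ onto $\mathscr H_{\ell,n}^{(0)}$. In particular, $\mathscr H_{\ell,n}^{(0)}\cong M_{n!\times n!}(Z)$ as $K$-algebras, by an isomorphism that sends each $z\in Z$ to the scalar matrix $z\cdot 1$. -/

import Mathlib

open scoped TensorProduct Nat

noncomputable section

namespace NilHecke

/-! ### The symmetric group as a Coxeter group

Indices are shifted by one: the generators `s_1, …, s_{n-1}` are indexed by `Fin (n - 1)`, and
`s_{r+1}` exchanges the letters `r` and `r + 1` of `Fin n`. -/

/-- The letter `r` of `Fin n`, for `r : Fin (n - 1)`. -/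
def lo {n : ℕ} (r : Fin (n - 1)) : Fin n := ⟨r.1, by omega⟩

/-- The letter `r + 1` of `Fin n`, for `r : Fin (n - 1)`. -/
def hi {n : ℕ} (r : Fin (n - 1)) : Fin n := ⟨r.1 + 1, by omega⟩

/-- The simple transposition exchanging `r` and `r + 1`. -/
def simple {n : ℕ} (r : Fin (n - 1)) : Equiv.Perm (Fin n) := Equiv.swap (lo r) (hi r)

/-- The permutation `s_{i_1} ⋯ s_{i_k}` expressed by a word `i_1, …, i_k`. -/
def wordProd {n : ℕ} (l : List (Fin (n - 1))) : Equiv.Perm (Fin n) := (l.map simple).prod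

/-- A word is a reduced expression (of the permutation it expresses) if no shorter word expresses
the same permutation. -/
def IsReduced {n : ℕ} (l : List (Fin (n - 1))) : Prop :=
  ∀ l' : List (Fin (n - 1)), wordProd l' = wordProd l → l.length ≤ l'.length

theorem exists_word {n : ℕ} (w : Equiv.Perm (Fin n)) :
    ∃ l : List (Fin (n - 1)), wordProd l = w := by
  cases n with
  | zero => exact ⟨[], Subsingleton.elim _ _⟩
  | succ m =>
    have hw : w ∈ Submonoid.closure
        (Set.range fun i : Fin m ↦ Equiv.swap i.castSucc i.succ) := by
      rw [Equiv.Perm.mclosure_swap_castSucc_succ]; trivial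
    induction hw using Submonoid.closure_induction with
    | mem x hx =>
      obtain ⟨i, rfl⟩ := hx
      exact ⟨[i], by simp [wordProd, simple, lo, hi]; rfl⟩
    | one => exact ⟨[], rfl⟩
    | mul x y _ _ hx hy =>
      obtain ⟨a, rfl⟩ := hx
      obtain ⟨b, rfl⟩ := hy
      exact ⟨a ++ b, by simp [wordProd]⟩

theorem exists_reduced {n : ℕ} (w : Equiv.Perm (Fin n)) :
    ∃ l : List (Fin (n - 1)), IsReduced l ∧ wordProd l = w := by
  classical
  have h : ∃ k : ℕ, ∃ l : List (Fin (n - 1)), l.length = k ∧ wordProd l = w :=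
    let ⟨l, hl⟩ := exists_word w
    ⟨_, l, rfl, hl⟩
  obtain ⟨l, hl, hw⟩ := Nat.find_spec h
  exact ⟨l, fun l' hl' ↦ hl ▸ Nat.find_min' h ⟨l', rfl, hl'.trans hw⟩, hw⟩

/-- A reduced expression of `w`. -/
def reducedWord {n : ℕ} (w : Equiv.Perm (Fin n)) : List (Fin (n - 1)) :=
  (exists_reduced w).choose

theorem reducedWord_isReduced {n : ℕ} (w : Equiv.Perm (Fin n)) : IsReduced (reducedWord w) :=
  (exists_reduced w).choose_spec.1

theorem wordProd_reducedWord {n : ℕ} (w : Equiv.Perm (Fin n)) : wordProd (reducedWord w) = w :=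
  (exists_reduced w).choose_spec.2

/-- The weak Bruhat order `u ⪰ w`: some reduced expression of `w` has an initial segment which
expresses `u`. The identity is the largest element. -/
def WeakGE {n : ℕ} (u w : Equiv.Perm (Fin n)) : Prop :=
  ∃ l : List (Fin (n - 1)), IsReduced l ∧ wordProd l = w ∧
    ∃ l' : List (Fin (n - 1)), l' <+: l ∧ wordProd l' = u

/-- The strict order `u ≻ w`. -/
def WeakGT {n : ℕ} (u w : Equiv.Perm (Fin n)) : Prop := WeakGE u w ∧ u ≠ w

/-- The longest element `w_0` of the symmetric group, which reverses the order of the letters. -/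
def longest (n : ℕ) : Equiv.Perm (Fin n) := Fin.revPerm

/-- An admissible enumeration `1 = w_1, w_2, …, w_{n!}` of the symmetric group:
`w_i⁻¹ ≻ w_j⁻¹` only if `i < j`. -/
structure IsAdmissible {n : ℕ} (w : Fin (n !) ≃ Equiv.Perm (Fin n)) : Prop where
  first : w ⟨0, Nat.factorial_pos n⟩ = 1
  lt_of_weakGT : ∀ i j, WeakGT (w i)⁻¹ (w j)⁻¹ → i < j

/-! ### The nilHecke algebra and its cyclotomic quotients -/

section Algebra

variable (K : Type*) [Field K]

/-- The free algebra on `ψ_1, …, ψ_{n-1}` and `y_1, …, y_n`. -/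
abbrev Free (n : ℕ) : Type _ := FreeAlgebra K (Fin (n - 1) ⊕ Fin n)

/-- The generator `ψ_r` of the free algebra. -/
def fpsi {n : ℕ} (r : Fin (n - 1)) : Free K n := FreeAlgebra.ι K (Sum.inl r)

/-- The generator `y_k` of the free algebra. -/
def fy {n : ℕ} (k : Fin n) : Free K n := FreeAlgebra.ι K (Sum.inr k)

/-- The defining relations of the nilHecke algebra of type `A`. -/
inductive Rel (n : ℕ) : Free K n → Free K n → Prop
  | psi_sq (r : Fin (n - 1)) : Rel n (fpsi K r * fpsi K r) 0
  | psi_comm (r k : Fin (n - 1)) (h : k.1 + 1 < r.1) :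
      Rel n (fpsi K r * fpsi K k) (fpsi K k * fpsi K r)
  | braid (r r' : Fin (n - 1)) (h : r'.1 = r.1 + 1) :
      Rel n (fpsi K r * fpsi K r' * fpsi K r) (fpsi K r' * fpsi K r * fpsi K r')
  | y_comm (r k : Fin n) : Rel n (fy K r * fy K k) (fy K k * fy K r)
  | psi_y_comm (r : Fin (n - 1)) (k : Fin n) (h₁ : k ≠ lo r) (h₂ : k ≠ hi r) :
      Rel n (fpsi K r * fy K k) (fy K k * fpsi K r)
  | psi_y (r : Fin (n - 1)) : Rel n (fpsi K r * fy K (hi r)) (fy K (lo r) * fpsi K r + 1)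
  | y_psi (r : Fin (n - 1)) : Rel n (fy K (hi r) * fpsi K r) (fpsi K r * fy K (lo r) + 1)

/-- The nilHecke algebra of type `A`. -/
def Affine (n : ℕ) : Type _ := RingQuot (Rel K n)

instance (n : ℕ) : Ring (Affine K n) := inferInstanceAs (Ring (RingQuot (Rel K n)))

instance (n : ℕ) : Algebra K (Affine K n) := inferInstanceAs (Algebra K (RingQuot (Rel K n)))

/-- The quotient map from the free algebra. -/
def mkAffine (n : ℕ) : Free K n →ₐ[K] Affine K n := RingQuot.mkAlgHom K (Rel K n)

/-- The relation `y_1 ^ ℓ = 0` (there is none if `n = 0`). -/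
inductive CycRel (ℓ n : ℕ) : Affine K n → Affine K n → Prop
  | y_pow (k : Fin n) (h : k.1 = 0) : CycRel ℓ n (mkAffine K n (fy K k) ^ ℓ) 0

/-- The cyclotomic nilHecke algebra: the quotient of the nilHecke algebra by the two-sided ideal
generated by `y_1 ^ ℓ`. -/
def Cyc (ℓ n : ℕ) : Type _ := RingQuot (CycRel K ℓ n)

instance (ℓ n : ℕ) : Ring (Cyc K ℓ n) := inferInstanceAs (Ring (RingQuot (CycRel K ℓ n)))

instance (ℓ n : ℕ) : Algebra K (Cyc K ℓ n) :=
  inferInstanceAs (Algebra K (RingQuot (CycRel K ℓ n)))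

/-- The canonical surjection from the nilHecke algebra. -/
def mkCyc (ℓ n : ℕ) : Affine K n →ₐ[K] Cyc K ℓ n := RingQuot.mkAlgHom K (CycRel K ℓ n)

variable {K}

/-- The generator `ψ_r` of the cyclotomic nilHecke algebra. -/
def psi (ℓ : ℕ) {n : ℕ} (r : Fin (n - 1)) : Cyc K ℓ n := mkCyc K ℓ n (mkAffine K n (fpsi K r))

/-- The generator `y_k` of the cyclotomic nilHecke algebra. -/
def y (ℓ : ℕ) {n : ℕ} (k : Fin n) : Cyc K ℓ n := mkCyc K ℓ n (mkAffine K n (fy K k))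

theorem mk_rel (ℓ : ℕ) {n : ℕ} {a b : Free K n} (h : Rel K n a b) :
    mkCyc K ℓ n (mkAffine K n a) = mkCyc K ℓ n (mkAffine K n b) :=
  congrArg (mkCyc K ℓ n) (RingQuot.mkAlgHom_rel K h)

theorem mk_cycRel {ℓ n : ℕ} {a b : Affine K n} (h : CycRel K ℓ n a b) :
    mkCyc K ℓ n a = mkCyc K ℓ n b :=
  RingQuot.mkAlgHom_rel K h

/-- The map to the opposite algebra fixing all generators, on the free algebra. -/
def freeStar (ℓ n : ℕ) : Free K n →ₐ[K] (Cyc K ℓ n)ᵐᵒᵖ :=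
  FreeAlgebra.lift K
    (Sum.elim (fun r ↦ MulOpposite.op (psi ℓ r)) (fun k ↦ MulOpposite.op (y ℓ k)))

@[simp] theorem freeStar_fpsi (ℓ : ℕ) {n : ℕ} (r : Fin (n - 1)) :
    freeStar (K := K) ℓ n (fpsi K r) = MulOpposite.op (psi ℓ r) := by
  simp [freeStar, fpsi]

@[simp] theorem freeStar_fy (ℓ : ℕ) {n : ℕ} (k : Fin n) :
    freeStar (K := K) ℓ n (fy K k) = MulOpposite.op (y ℓ k) := by
  simp [freeStar, fy]

theorem freeStar_rel (ℓ n : ℕ) ⦃a b : Free K n⦄ (h : Rel K n a b) :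
    freeStar ℓ n a = freeStar ℓ n b := by
  apply MulOpposite.unop_injective
  cases h with
  | psi_sq r => simpa [psi] using mk_rel ℓ (Rel.psi_sq (K := K) r)
  | psi_comm r k h => simpa [psi] using (mk_rel ℓ (Rel.psi_comm (K := K) r k h)).symm
  | braid r r' h => simpa [psi, mul_assoc] using mk_rel ℓ (Rel.braid (K := K) r r' h)
  | y_comm r k => simpa [y] using (mk_rel ℓ (Rel.y_comm (K := K) r k)).symm
  | psi_y_comm r k h₁ h₂ =>
    simpa [psi, y] using (mk_rel ℓ (Rel.psi_y_comm (K := K) r k h₁ h₂)).symm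
  | psi_y r => simpa [psi, y] using mk_rel ℓ (Rel.y_psi (K := K) r)
  | y_psi r => simpa [psi, y] using mk_rel ℓ (Rel.psi_y (K := K) r)

/-- The map to the opposite algebra fixing all generators, on the nilHecke algebra. -/
def affineStar (ℓ n : ℕ) : Affine K n →ₐ[K] (Cyc K ℓ n)ᵐᵒᵖ :=
  RingQuot.liftAlgHom K ⟨freeStar ℓ n, freeStar_rel ℓ n⟩

theorem affineStar_mk (ℓ n : ℕ) (a : Free K n) :
    affineStar ℓ n (mkAffine K n a) = freeStar ℓ n a :=
  RingQuot.liftAlgHom_mkAlgHom_apply K _ _ a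

theorem affineStar_rel (ℓ n : ℕ) ⦃a b : Affine K n⦄ (h : CycRel K ℓ n a b) :
    affineStar ℓ n a = affineStar ℓ n b := by
  apply MulOpposite.unop_injective
  cases h with
  | y_pow k h => simpa [affineStar_mk, y] using mk_cycRel (CycRel.y_pow (K := K) (ℓ := ℓ) k h)

/-- The anti-automorphism `∗` fixing all generators, as a homomorphism to the opposite algebra. -/
def starHom (ℓ n : ℕ) : Cyc K ℓ n →ₐ[K] (Cyc K ℓ n)ᵐᵒᵖ :=
  RingQuot.liftAlgHom K ⟨affineStar ℓ n, affineStar_rel ℓ n⟩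

/-- The anti-automorphism `x ↦ x^∗` of the cyclotomic nilHecke algebra which fixes each of the
generators `ψ_r` and `y_k`. -/
def anti {ℓ n : ℕ} (x : Cyc K ℓ n) : Cyc K ℓ n := (starHom ℓ n x).unop

theorem anti_mk {ℓ n : ℕ} (a : Free K n) :
    anti (mkCyc K ℓ n (mkAffine K n a)) = (freeStar ℓ n a).unop :=
  congrArg MulOpposite.unop
    ((RingQuot.liftAlgHom_mkAlgHom_apply K _ _ _).trans (affineStar_mk ℓ n a))

theorem anti_psi {ℓ n : ℕ} (r : Fin (n - 1)) : anti (psi (K := K) ℓ r) = psi ℓ r := by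
  rw [psi, anti_mk, freeStar_fpsi]; rfl

theorem anti_y {ℓ n : ℕ} (k : Fin n) : anti (y (K := K) ℓ k) = y ℓ k := by
  rw [y, anti_mk, freeStar_fy]; rfl

theorem anti_mul {ℓ n : ℕ} (x x' : Cyc K ℓ n) : anti (x * x') = anti x' * anti x := by
  simp [anti]

variable (K)

/-- `ψ_w = ψ_{i_1} ⋯ ψ_{i_k}` for a reduced expression `w = s_{i_1} ⋯ s_{i_k}`; by the braid
relations this does not depend on the reduced expression. -/
def psiPerm (ℓ : ℕ) {n : ℕ} (w : Equiv.Perm (Fin n)) : Cyc K ℓ n :=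
  ((reducedWord w).map (psi ℓ)).prod

/-- The monomial `y_1 ^ (n-1) y_2 ^ (n-2) ⋯ y_{n-1}`. -/
def yStair (ℓ n : ℕ) : Cyc K ℓ n := (List.ofFn fun k : Fin n ↦ y ℓ k ^ (n - 1 - k.1)).prod

/-- The element
`F'_{z₁, z₂} = ψ_{w_0 z₁}^∗ (y_1 ^ (n-1) ⋯ y_{n-1}) ψ_{w_0} (y_1 ^ (n-1) ⋯ y_{n-1}) ψ_{z₂}`. -/
def FPrime (ℓ : ℕ) {n : ℕ} (z₁ z₂ : Equiv.Perm (Fin n)) : Cyc K ℓ n :=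
  anti (psiPerm K ℓ (longest n * z₁)) * yStair K ℓ n * psiPerm K ℓ (longest n) *
    yStair K ℓ n * psiPerm K ℓ z₂

/-- The elements `𝔣_{w_i, w_j} = F'_{w_i, w_j} - ∑_{k < i} 𝔣_{w_k, w_k} F'_{w_i, w_j}`, by
recursion on `i`. -/
def fUnit (ℓ : ℕ) {n : ℕ} (w : Fin (n !) ≃ Equiv.Perm (Fin n)) (i j : Fin (n !)) : Cyc K ℓ n :=
  FPrime K ℓ (w i) (w j) -
    ∑ k : {k : Fin (n !) // k < i}, fUnit ℓ w k.1 k.1 * FPrime K ℓ (w i) (w j)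
termination_by i.1
decreasing_by exact k.2

end Algebra

end NilHecke

end

/-! Write `p` for `ψ_{w_0}` and `t` for the staircase monomial in the `y_k`. The nilHecke relations
give `p t p = ± p`, hence `p t p t p = p` (`NilRel.stair_sandwich`). By Matsumoto's theorem and
`ψ_r² = 0`, the product `ψ_u ψ_{w_0 v}^*` equals `p` when `u = v` and vanishes unless `u⁻¹ ⪰ v⁻¹`.
Along an admissible enumeration the elements `F'` therefore multiply by a unitriangular rule, and
the recursion for `𝔣` is the Gram–Schmidt process turning them into matrix units
(`mul_eq_of_unitriangular`).

The remaining point is `∑ 𝔣_{ii} = 1`, which is proved without a basis or a dimension formula. Put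
`e = 𝔣_{11} = p t p t`. Three facts suffice (`sum_eq_one_of_span`). (a) The corner `e H e` is
commutative: `*` reverses products yet fixes `p H p` pointwise (`stair_mul_comm`). (b) The left
ideal `H e` is spanned by `n!` elements over central elements: `H p = K[y] p`, symmetric polynomials
in the `y_k` are central, and `n!` polynomials span all polynomials over the symmetric ones
(`exists_symmetric_span`). (c) An element `d` with `d H p = 0` is zero
(`NilRel.eq_zero_of_forall_mul_stair`). By (b), the `n!` orthogonal units `𝔣_{i1}` and the `n!`
spanning elements are related by square matrices over the commutative ring `e H e`. A one-sided
inverse there is two-sided, so `∑ 𝔣_{ii}` fixes `H e`, and (c) finishes.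

A complete system of matrix units with a commutative corner identifies the algebra with matrices
over its center (`exists_matrix_algEquiv`). -/

namespace NilHecke

/-! ### Descending products and staircase products -/

section Stair

variable {M N : Type*} [Monoid M] [Monoid N]

/-- The product `x_{m-1} ⋯ x_1 x_0`. -/
def desc (x : ℕ → M) : ℕ → M
  | 0 => 1
  | m + 1 => x m * desc x m

/-- The product `x_0 x_1 ⋯ x_{m-1}`. -/
def asc (x : ℕ → M) : ℕ → M
  | 0 => 1
  | m + 1 => asc x m * x m

/-- The product `(x_0) (x_1 x_0) ⋯ (x_{m-2} ⋯ x_0)`. -/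
def stair (x : ℕ → M) : ℕ → M
  | 0 => 1
  | m + 1 => stair x m * desc x m

theorem map_desc (f : M →* N) (x : ℕ → M) (m : ℕ) :
    f (desc x m) = desc (fun i ↦ f (x i)) m := by
  induction m with
  | zero => simp [desc]
  | succ m ih => simp [desc, ih]

theorem map_stair (f : M →* N) (x : ℕ → M) (m : ℕ) :
    f (stair x m) = stair (fun i ↦ f (x i)) m := by
  induction m with
  | zero => simp [stair]
  | succ m ih => simp [stair, ih, map_desc]

theorem commute_desc {x : ℕ → M} {a : M} {m : ℕ} (h : ∀ i < m, Commute a (x i)) :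
    Commute a (desc x m) := by
  induction m with
  | zero => exact Commute.one_right a
  | succ m ih => exact (h m (by omega)).mul_right (ih fun i hi ↦ h i (by omega))

theorem commute_asc {x : ℕ → M} {a : M} {m : ℕ} (h : ∀ i < m, Commute a (x i)) :
    Commute a (asc x m) := by
  induction m with
  | zero => exact Commute.one_right a
  | succ m ih => exact (ih fun i hi ↦ h i (by omega)).mul_right (h m (by omega))

theorem commute_stair {x : ℕ → M} {a : M} {m : ℕ} (h : ∀ i, i + 1 < m → Commute a (x i)) :
    Commute a (stair x m) := by
  induction m with
  | zero => exact Commute.one_right a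
  | succ m ih =>
    exact (ih fun i hi ↦ h i (by omega)).mul_right (commute_desc fun i hi ↦ h i (by omega))

/-- If far apart factors commute, the staircase product can be built from either side. -/
theorem asc_mul_stair {x : ℕ → M} {n : ℕ}
    (h : ∀ i j, i + 1 < j → j + 1 < n → x i * x j = x j * x i) {m : ℕ} (hm : m < n) :
    asc x m * stair x m = stair x m * desc x m := by
  induction m with
  | zero => simp [asc, stair, desc]
  | succ m ih =>
    have hc : x m * stair x m = stair x m * x m :=
      commute_stair fun i hi ↦ (h i m hi hm).symm
    calc asc x (m + 1) * stair x (m + 1)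
        = asc x m * (x m * stair x m) * desc x m := by simp only [asc, stair, mul_assoc]
      _ = (asc x m * stair x m) * x m * desc x m := by rw [hc]; simp only [mul_assoc]
      _ = stair x (m + 1) * desc x (m + 1) := by
        rw [ih (by omega)]; simp only [desc, stair, mul_assoc]

theorem desc_eq_prod {M : Type*} [CommMonoid M] (x : ℕ → M) (m : ℕ) :
    desc x m = ∏ i ∈ Finset.range m, x i := by
  induction m with
  | zero => rfl
  | succ m ih => rw [desc, ih, Finset.prod_range_succ, mul_comm]

theorem stair_eq_prod {M : Type*} [CommMonoid M] (x : ℕ → M) (m : ℕ) :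
    stair x m = ∏ i ∈ Finset.range m, x i ^ (m - 1 - i) := by
  induction m with
  | zero => rfl
  | succ m ih =>
    rw [stair, ih, desc_eq_prod, Finset.prod_range_succ, ← Finset.prod_mul_distrib]
    simp only [Nat.add_sub_cancel, Nat.sub_self, pow_zero, mul_one]
    refine Finset.prod_congr rfl fun i hi ↦ ?_
    rw [← pow_succ]
    congr 1
    have := Finset.mem_range.1 hi
    omega

end Stair

/-! ### The nilHecke relations in a ring -/

/-- The elements `ψ_0, …, ψ_{n-2}` and `y_0, …, y_{n-1}` of a ring satisfy the relations of the
nilHecke algebra. -/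
structure NilRel {R : Type*} [Ring R] (n : ℕ) (ψ y : ℕ → R) : Prop where
  sq : ∀ r, r + 1 < n → ψ r * ψ r = 0
  comm : ∀ r k, r + 1 < k → k + 1 < n → ψ r * ψ k = ψ k * ψ r
  braid : ∀ r, r + 2 < n → ψ r * ψ (r + 1) * ψ r = ψ (r + 1) * ψ r * ψ (r + 1)
  y_comm : ∀ r k, r < n → k < n → y r * y k = y k * y r
  psi_y_comm : ∀ r k, r + 1 < n → k < n → k ≠ r → k ≠ r + 1 → ψ r * y k = y k * ψ r
  psi_y : ∀ r, r + 1 < n → ψ r * y (r + 1) = y r * ψ r + 1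
  y_psi : ∀ r, r + 1 < n → y (r + 1) * ψ r = ψ r * y r + 1

namespace NilRel

variable {R : Type*} [Ring R] {n : ℕ} {ψ y : ℕ → R}

theorem asc_mul_stair (H : NilRel n ψ y) {m : ℕ} (hm : m < n) :
    asc ψ m * stair ψ m = stair ψ (m + 1) :=
  NilHecke.asc_mul_stair H.comm hm

/-- Building the staircase from the left handles all but the last index by induction. For the last
index, far commutation and one braid move bring a smaller `ψ` next to the smaller staircase, which
it annihilates. -/
theorem stair_mul_psi (H : NilRel n ψ y) {m : ℕ} (hm : m ≤ n) {r : ℕ} (hr : r + 1 < m) :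
    stair ψ m * ψ r = 0 := by
  induction m generalizing r with
  | zero => omega
  | succ m ih =>
    rcases Nat.lt_or_ge (r + 1) m with h | h
    · rw [← H.asc_mul_stair (by omega), mul_assoc, ih (by omega) h, mul_zero]
    · obtain rfl : m = r + 1 := by omega
      rcases r with _ | r
      · simp only [stair, desc, mul_one, one_mul]
        exact H.sq 0 hm
      · have hc : desc ψ r * ψ (r + 1) = ψ (r + 1) * desc ψ r :=
          (commute_desc fun i hi ↦ (H.comm i (r + 1) (by omega) (by omega)).symm).symm
        calc stair ψ (r + 1 + 1 + 1) * ψ (r + 1)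
            = stair ψ (r + 2) * (ψ (r + 1) * ψ r * (desc ψ r * ψ (r + 1))) := by
              rw [stair, desc, desc]; simp only [mul_assoc]
          _ = stair ψ (r + 2) * (ψ (r + 1) * ψ r * ψ (r + 1) * desc ψ r) := by
              rw [hc]; simp only [mul_assoc]
          _ = stair ψ (r + 2) * ψ r * (ψ (r + 1) * ψ r * desc ψ r) := by
              rw [← H.braid r (by omega)]; simp only [mul_assoc]
          _ = 0 := by rw [ih (by omega) (by omega), zero_mul]

theorem psi_mul_stair (H : NilRel n ψ y) {m : ℕ} (hm : m ≤ n) {r : ℕ} (hr : r + 1 < m) :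
    ψ r * stair ψ m = 0 := by
  induction m generalizing r with
  | zero => omega
  | succ m ih =>
    rcases Nat.lt_or_ge (r + 1) m with h | h
    · rw [stair, ← mul_assoc, ih (by omega) h, zero_mul]
    · obtain rfl : m = r + 1 := by omega
      rcases r with _ | r
      · simp only [stair, desc, mul_one, one_mul]
        exact H.sq 0 hm
      · have hc : ψ (r + 1) * asc ψ r = asc ψ r * ψ (r + 1) :=
          commute_asc fun i hi ↦ (H.comm i (r + 1) (by omega) (by omega)).symm
        calc ψ (r + 1) * stair ψ (r + 1 + 1 + 1)
            = ψ (r + 1) * asc ψ r * (ψ r * (ψ (r + 1) * stair ψ (r + 2))) := by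
              rw [← H.asc_mul_stair (m := r + 1 + 1) (by omega), asc, asc]; simp only [mul_assoc]
          _ = asc ψ r * (ψ (r + 1) * ψ r * ψ (r + 1)) * stair ψ (r + 2) := by
              rw [hc]; simp only [mul_assoc]
          _ = asc ψ r * (ψ r * ψ (r + 1)) * (ψ r * stair ψ (r + 2)) := by
              rw [← H.braid r (by omega)]; simp only [mul_assoc]
          _ = 0 := by rw [ih (by omega) (by omega), mul_zero]

theorem psi_y_self (H : NilRel n ψ y) {r : ℕ} (hr : r + 1 < n) :
    ψ r * y r = y (r + 1) * ψ r - 1 := by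
  rw [H.y_psi r hr, add_sub_cancel_right]

/-- The product `y_{m-1} ⋯ y_0` is symmetric under the first `m` letters. -/
theorem commute_psi_desc (H : NilRel n ψ y) {m : ℕ} (hm : m ≤ n) {r : ℕ} (hr : r + 1 < m) :
    Commute (ψ r) (desc y m) := by
  induction m with
  | zero => omega
  | succ m ih =>
    rcases Nat.lt_or_ge (r + 1) m with h | h
    · exact Commute.mul_right (H.psi_y_comm r m (by omega) (by omega) (by omega) (by omega))
        (ih (by omega) h)
    · obtain rfl : m = r + 1 := by omega
      have hc : Commute (ψ r) (desc y r) := commute_desc fun i hi ↦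
        H.psi_y_comm r i (by omega) (by omega) (by omega) (by omega)
      have h2 : Commute (ψ r) (y (r + 1) * y r) := by
        change ψ r * (y (r + 1) * y r) = y (r + 1) * y r * ψ r
        rw [← mul_assoc, H.psi_y r (by omega), add_mul, mul_assoc, H.psi_y_self (by omega),
          H.y_comm (r + 1) r (by omega) (by omega)]
        noncomm_ring
      rw [desc, desc, ← mul_assoc]
      exact h2.mul_right hc

/-- In `ψ_j y_j = y_{j+1} ψ_j - 1` the first term dies, because `ψ_j` passes the lower `y`'s and
annihilates the staircase. Each pair thus contributes a factor `-1`. -/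
theorem asc_mul_desc_mul_stair (H : NilRel n ψ y) {m : ℕ} (hm : m < n) {j : ℕ} (hj : j ≤ m) :
    asc ψ j * desc y j * stair ψ (m + 1) = (-1) ^ j * stair ψ (m + 1) := by
  induction j with
  | zero => simp [asc, desc]
  | succ j ih =>
    have hc : ψ j * desc y j = desc y j * ψ j := commute_desc fun i hi ↦
      H.psi_y_comm j i (by omega) (by omega) (by omega) (by omega)
    calc asc ψ (j + 1) * desc y (j + 1) * stair ψ (m + 1)
        = asc ψ j * (ψ j * y j) * desc y j * stair ψ (m + 1) := by
          simp only [asc, desc, mul_assoc]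
      _ = asc ψ j * y (j + 1) * (ψ j * desc y j) * stair ψ (m + 1)
            - asc ψ j * desc y j * stair ψ (m + 1) := by
          rw [H.psi_y_self (by omega)]; noncomm_ring
      _ = asc ψ j * y (j + 1) * desc y j * (ψ j * stair ψ (m + 1))
            - asc ψ j * desc y j * stair ψ (m + 1) := by
          rw [hc]; simp only [mul_assoc]
      _ = (-1) ^ (j + 1) * stair ψ (m + 1) := by
          rw [H.psi_mul_stair (by omega) (by omega), ih (by omega), pow_succ']
          simp

/-- The symmetric product `y_{m-1} ⋯ y_0` commutes with the staircase on `m` letters, which exposes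
the induction hypothesis. The value of the sign is irrelevant: it is squared in `stair_sandwich`. -/
theorem stair_mul_stair_mul_stair (H : NilRel n ψ y) {m : ℕ} (hm : m ≤ n) :
    ∃ k : ℕ, stair ψ m * stair y m * stair ψ m = (-1) ^ k * stair ψ m := by
  induction m with
  | zero => exact ⟨0, by simp [stair]⟩
  | succ m ih =>
    obtain ⟨k, hk⟩ := ih (by omega)
    have hc : desc y m * stair ψ m = stair ψ m * desc y m :=
      commute_stair fun i hi ↦ (H.commute_psi_desc (by omega) hi).symm
    have h1 : asc ψ m * (-1) ^ k = (-1) ^ k * asc ψ m :=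
      (Commute.neg_one_right _).pow_right k
    refine ⟨k + m, ?_⟩
    calc stair ψ (m + 1) * stair y (m + 1) * stair ψ (m + 1)
        = asc ψ m * (stair ψ m * stair y m * (desc y m * stair ψ m)) * desc ψ m := by
          conv_lhs => enter [1, 1]; rw [← H.asc_mul_stair (by omega)]
          simp only [stair, mul_assoc]
      _ = asc ψ m * ((stair ψ m * stair y m * stair ψ m) * desc y m) * desc ψ m := by
          rw [hc]; simp only [mul_assoc]
      _ = asc ψ m * (-1) ^ k * (stair ψ m * desc y m) * desc ψ m := by
          rw [hk]; simp only [mul_assoc]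
      _ = (-1) ^ k * (asc ψ m * desc y m * stair ψ (m + 1)) := by
          rw [h1, ← hc]; simp only [stair, mul_assoc]
      _ = (-1) ^ (k + m) * stair ψ (m + 1) := by
          rw [H.asc_mul_desc_mul_stair (by omega) le_rfl, pow_add, mul_assoc]

theorem stair_sandwich (H : NilRel n ψ y) :
    stair ψ n * stair y n * stair ψ n * stair y n * stair ψ n = stair ψ n := by
  obtain ⟨k, hk⟩ := H.stair_mul_stair_mul_stair le_rfl
  rw [hk, mul_assoc ((-1) ^ k), mul_assoc ((-1) ^ k), hk, ← mul_assoc, ← pow_add, ← two_mul,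
    pow_mul]
  simp

/-! ### The ideal generated by `ψ_{w_0}` -/

/-- The product of `ψ_{w_0}` of the first `m` letters with the first `j` factors of
`ψ_{m-1} ⋯ ψ_0`. -/
def partialStair (ψ : ℕ → R) (m : ℕ) : ℕ → R
  | 0 => stair ψ m
  | j + 1 => partialStair ψ m j * ψ (m - 1 - j)

theorem partialStair_mul_desc (ψ : ℕ → R) (m j : ℕ) (hj : j ≤ m) :
    partialStair ψ m j * desc ψ (m - j) = stair ψ (m + 1) := by
  induction j with
  | zero => rfl
  | succ j ih =>
    rw [← ih (by omega), partialStair]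
    obtain ⟨k, rfl⟩ : ∃ k, m = k + (j + 1) := ⟨m - (j + 1), by omega⟩
    rw [show k + (j + 1) - 1 - j = k by omega, show k + (j + 1) - (j + 1) = k by omega,
      show k + (j + 1) - j = k + 1 by omega, desc, mul_assoc]

theorem partialStair_mul_psi (H : NilRel n ψ y) {m : ℕ} (hm : m < n) {j k : ℕ}
    (hk : k + j + 1 < m) : partialStair ψ m j * ψ k = 0 := by
  induction j with
  | zero => exact H.stair_mul_psi (by omega) (by omega)
  | succ j ih =>
    rw [partialStair, mul_assoc, ← H.comm k (m - 1 - j) (by omega) (by omega), ← mul_assoc,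
      ih (by omega), zero_mul]

/-- A twisted commutator with `y` strips the last factor `ψ_k`, since `y_{k+1} ψ_k - ψ_k y_k = 1`.
The other term ends in a product killed by `partialStair_mul_psi`. -/
theorem y_mul_partialStair (H : NilRel n ψ y) {m : ℕ} (hm : m < n) {j k : ℕ}
    (hk : k + j + 1 = m) :
    y m * partialStair ψ m (j + 1) - partialStair ψ m (j + 1) * y k = partialStair ψ m j := by
  induction j generalizing k with
  | zero =>
    obtain rfl : m = k + 1 := hk.symm
    have hc : y (k + 1) * stair ψ (k + 1) = stair ψ (k + 1) * y (k + 1) :=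
      commute_stair fun i hi ↦
        (H.psi_y_comm i (k + 1) (by omega) hm (by omega) (by omega)).symm
    simp only [partialStair, Nat.add_sub_cancel, Nat.sub_zero]
    rw [mul_assoc (stair ψ (k + 1)), H.psi_y_self hm, ← mul_assoc, hc]
    noncomm_ring
  | succ j ih =>
    have h := ih (k := k + 1) (by omega)
    have h0 := H.partialStair_mul_psi hm (j := j) (k := k) (by omega)
    rw [partialStair, show m - 1 - (j + 1) = k by omega, mul_assoc _ (ψ k),
      H.psi_y_self (by omega)]
    have h1 : partialStair ψ m (j + 1) * y (k + 1)
        = y m * partialStair ψ m (j + 1) - partialStair ψ m j := by rw [← h]; abel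
    rw [mul_sub, ← mul_assoc, ← mul_assoc, h1, sub_mul, h0]
    noncomm_ring

/-- The element `ψ_{w_0}` generates the unit ideal. -/
theorem eq_zero_of_forall_mul_stair (H : NilRel n ψ y) {d : R} {m : ℕ} (hm : m ≤ n)
    (hd : ∀ h, d * h * stair ψ m = 0) : d = 0 := by
  induction m with
  | zero => simpa [stair] using hd 1
  | succ m ih =>
    -- Quantifying over `h` absorbs the left factor `y m` of the twisted commutator, so annihilation
    -- passes from each partial staircase to the one with a factor fewer.
    have key : ∀ i, i ≤ m → ∀ h, d * h * partialStair ψ m (m - i) = 0 := by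
      intro i hi
      induction i with
      | zero =>
        intro h
        have := partialStair_mul_desc ψ m m le_rfl
        rw [Nat.sub_self, desc, mul_one] at this
        rw [Nat.sub_zero, this, hd]
      | succ i ih' =>
        intro h
        have h1 := H.y_mul_partialStair (j := m - (i + 1)) (k := i) (m := m) (by omega) (by omega)
        have h2 := ih' (by omega)
        rw [show m - (i + 1) + 1 = m - i by omega] at h1
        rw [← h1, mul_sub, ← mul_assoc, ← mul_assoc, h2 h, mul_assoc d, h2, zero_mul, sub_zero]
    refine ih (by omega) fun h ↦ ?_
    simpa [partialStair] using key m le_rfl h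

end NilRel

/-! ### Inversions of permutations -/

section Inversions

variable {n : ℕ}

theorem lo_lt_hi (r : Fin (n - 1)) : lo r < hi r := by
  simp [lo, hi, Fin.lt_def]

theorem simple_mul_self (r : Fin (n - 1)) : simple r * simple r = 1 := Equiv.swap_mul_self _ _

theorem simple_inv (r : Fin (n - 1)) : (simple r)⁻¹ = simple r := Equiv.swap_inv _ _

theorem simple_lo (r : Fin (n - 1)) : simple r (lo r) = hi r := Equiv.swap_apply_left _ _

theorem simple_hi (r : Fin (n - 1)) : simple r (hi r) = lo r := Equiv.swap_apply_right _ _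

theorem simple_of_ne {r : Fin (n - 1)} {i : Fin n} (h₁ : i ≠ lo r) (h₂ : i ≠ hi r) :
    simple r i = i := Equiv.swap_apply_of_ne_of_ne h₁ h₂

theorem simple_simple (r : Fin (n - 1)) (i : Fin n) : simple r (simple r i) = i :=
  Equiv.swap_apply_self _ _ _

theorem wordProd_append (l l' : List (Fin (n - 1))) :
    wordProd (l ++ l') = wordProd l * wordProd l' := by
  simp [wordProd]

theorem wordProd_singleton (r : Fin (n - 1)) : wordProd [r] = simple r := by simp [wordProd]

theorem wordProd_reverse (l : List (Fin (n - 1))) : wordProd l.reverse = (wordProd l)⁻¹ := by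
  induction l with
  | nil => simp [wordProd]
  | cons r l ih =>
    rw [List.reverse_cons, wordProd_append, ih, wordProd_singleton]
    simp [wordProd, simple_inv]

/-- The pairs of positions exchanged in order by a permutation. -/
def inversions (w : Equiv.Perm (Fin n)) : Finset (Fin n × Fin n) :=
  Finset.univ.filter fun p ↦ p.1 < p.2 ∧ w p.2 < w p.1

theorem mem_inversions {w : Equiv.Perm (Fin n)} {i j : Fin n} :
    (i, j) ∈ inversions w ↔ i < j ∧ w j < w i := by
  simp [inversions]

/-- The number of inversions of a permutation. -/
def inv (w : Equiv.Perm (Fin n)) : ℕ := (inversions w).card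

theorem simple_lt_simple {r : Fin (n - 1)} {i j : Fin n} (h : i < j)
    (hr : ¬(i = lo r ∧ j = hi r)) : simple r i < simple r j := by
  have e1 : (lo r).1 = r.1 := rfl
  have e2 : (hi r).1 = r.1 + 1 := rfl
  simp only [simple, Equiv.swap_apply_def]
  simp only [Fin.lt_def, Fin.ext_iff] at *
  split_ifs <;> omega

/-- Relabelling positions by `s_r` maps the inversions of `w` injectively into those of `w s_r`; the
only new one is the pair `(r, r + 1)`. -/
theorem inv_mul_simple_of_lt {w : Equiv.Perm (Fin n)} {r : Fin (n - 1)}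
    (h : w (lo r) < w (hi r)) : inv (w * simple r) = inv w + 1 := by
  have hE : inversions (w * simple r) = insert (lo r, hi r) ((inversions w).map
      ((simple r).prodCongr (simple r)).toEmbedding) := by
    ext ⟨i, j⟩
    simp only [mem_inversions, Finset.mem_insert, Finset.mem_map, Equiv.coe_toEmbedding,
      Prod.exists, Equiv.prodCongr_apply, Prod.map_apply, Prod.mk.injEq, Equiv.Perm.mul_apply]
    constructor
    · rintro ⟨hij, hw⟩
      by_cases hr : i = lo r ∧ j = hi r
      · exact Or.inl hr
      · exact Or.inr ⟨simple r i, simple r j, ⟨simple_lt_simple hij hr, hw⟩,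
          simple_simple r i, simple_simple r j⟩
    · rintro (⟨rfl, rfl⟩ | ⟨a, b, ⟨hab, hw⟩, rfl, rfl⟩)
      · rw [simple_lo, simple_hi]
        exact ⟨lo_lt_hi r, h⟩
      · rw [simple_simple, simple_simple]
        refine ⟨simple_lt_simple hab ?_, hw⟩
        rintro ⟨rfl, rfl⟩
        exact absurd h hw.not_gt
  rw [inv, hE, Finset.card_insert_of_notMem, Finset.card_map, inv]
  simp only [mem_inversions, Finset.mem_map, Prod.exists, Equiv.coe_toEmbedding,
    Equiv.prodCongr_apply, Prod.map_apply, Prod.mk.injEq, not_exists, not_and, and_imp]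
  intro a b hab _ ha hb
  have ha' : a = hi r := by rw [← simple_simple r a, ha, simple_lo]
  have hb' : b = lo r := by rw [← simple_simple r b, hb, simple_hi]
  rw [ha', hb'] at hab
  exact absurd hab (lo_lt_hi r).not_gt

theorem inv_mul_simple_of_gt {w : Equiv.Perm (Fin n)} {r : Fin (n - 1)}
    (h : w (hi r) < w (lo r)) : inv (w * simple r) + 1 = inv w := by
  have := inv_mul_simple_of_lt (w := w * simple r) (r := r)
    (by simpa [simple_lo, simple_hi] using h)
  rw [← this, mul_assoc, simple_mul_self, mul_one]

theorem inv_mul_simple_le (w : Equiv.Perm (Fin n)) (r : Fin (n - 1)) :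
    inv (w * simple r) ≤ inv w + 1 := by
  rcases lt_or_gt_of_ne (w.injective.ne (lo_lt_hi r).ne) with h | h
  · exact (inv_mul_simple_of_lt h).le
  · have := inv_mul_simple_of_gt h
    omega

theorem inv_one : inv (1 : Equiv.Perm (Fin n)) = 0 := by
  rw [inv, Finset.card_eq_zero, inversions, Finset.filter_eq_empty_iff]
  rintro ⟨i, j⟩ _ ⟨h, h'⟩
  exact absurd h h'.not_gt

theorem inv_wordProd_le (l : List (Fin (n - 1))) : inv (wordProd l) ≤ l.length := by
  induction l using List.reverseRecOn with
  | nil => simp [wordProd, inv_one]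
  | append_singleton l r ih =>
    rw [wordProd_append, wordProd_singleton, List.length_append, List.length_singleton]
    exact (inv_mul_simple_le _ _).trans (Nat.succ_le_succ ih)

theorem exists_descent {w : Equiv.Perm (Fin n)} (hw : w ≠ 1) :
    ∃ r : Fin (n - 1), w (hi r) < w (lo r) := by
  by_contra! h
  apply hw
  have hmono : StrictMono w := by
    cases n with
    | zero => exact fun i ↦ i.elim0
    | succ m =>
      exact Fin.strictMono_iff_lt_succ.2 fun i ↦
        lt_of_le_of_ne (h i) (w.injective.ne (lo_lt_hi (n := m + 1) i).ne)
  ext i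
  have : Set.range w = Set.range (id : Fin n → Fin n) := by
    rw [w.surjective.range_eq, Set.range_id]
  rw [(hmono.range_inj strictMono_id).1 this]
  rfl

theorem exists_word_length_eq_inv (w : Equiv.Perm (Fin n)) :
    ∃ l : List (Fin (n - 1)), wordProd l = w ∧ l.length = inv w := by
  induction hk : inv w generalizing w with
  | zero =>
    rcases eq_or_ne w 1 with rfl | hw
    · exact ⟨[], rfl, rfl⟩
    · obtain ⟨r, hr⟩ := exists_descent hw
      have := inv_mul_simple_of_gt hr
      omega
  | succ k ih =>
    have hw : w ≠ 1 := by
      rintro rfl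
      rw [inv_one] at hk
      omega
    obtain ⟨r, hr⟩ := exists_descent hw
    have := inv_mul_simple_of_gt hr
    obtain ⟨l, hl, hlen⟩ := ih (w * simple r) (by omega)
    refine ⟨l ++ [r], ?_, by simp [hlen]⟩
    rw [wordProd_append, wordProd_singleton, hl, mul_assoc, simple_mul_self, mul_one]

/-- Removing descents one at a time produces a word of length `inv`, and no word can be shorter.
From here on reducedness is a numerical condition. -/
theorem isReduced_iff {l : List (Fin (n - 1))} : IsReduced l ↔ l.length = inv (wordProd l) := by
  constructor
  · intro h
    obtain ⟨l', hl', hlen⟩ := exists_word_length_eq_inv (wordProd l)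
    exact le_antisymm (hlen ▸ h l' hl') (inv_wordProd_le l)
  · intro h l' hl'
    rw [h, ← hl']
    exact inv_wordProd_le l'

theorem length_reducedWord (w : Equiv.Perm (Fin n)) : (reducedWord w).length = inv w := by
  rw [isReduced_iff.1 (reducedWord_isReduced w), wordProd_reducedWord]

theorem inv_inv_le (w : Equiv.Perm (Fin n)) : inv w⁻¹ ≤ inv w := by
  obtain ⟨l, rfl, hlen⟩ := exists_word_length_eq_inv w
  rw [← wordProd_reverse, ← hlen, ← List.length_reverse]
  exact inv_wordProd_le _

theorem inv_inv (w : Equiv.Perm (Fin n)) : inv w⁻¹ = inv w :=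
  le_antisymm (inv_inv_le w) (by simpa using inv_inv_le w⁻¹)

theorem longest_inv : (longest n)⁻¹ = longest n := Equiv.symm_bijective.injective rfl

/-- Reversing the values makes `w_0 w` invert exactly the pairs that `w` does not. -/
theorem inv_longest_mul (w : Equiv.Perm (Fin n)) :
    inv (longest n * w) + inv w = inv (longest n) := by
  have h1 : inversions (longest n) = Finset.univ.filter fun p ↦ p.1 < p.2 := by
    ext ⟨i, j⟩
    simp [inversions, longest]
  have h2 : inversions (longest n * w) = (inversions (longest n)).filter
      fun p ↦ ¬ w p.2 < w p.1 := by
    rw [h1]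
    ext ⟨i, j⟩
    simp only [inversions, longest, Finset.mem_filter, Finset.mem_univ, true_and,
      Equiv.Perm.mul_apply, Fin.revPerm_apply, Fin.rev_lt_rev, not_lt, and_congr_right_iff]
    exact fun h ↦ ⟨le_of_lt, fun h' ↦ lt_of_le_of_ne h' (w.injective.ne h.ne)⟩
  have h3 : inversions w = (inversions (longest n)).filter fun p ↦ w p.2 < w p.1 := by
    rw [h1, inversions, Finset.filter_filter]
  rw [inv, inv, inv, h2, h3, add_comm]
  exact Finset.card_filter_add_card_filter_not _

theorem inv_mul_longest (w : Equiv.Perm (Fin n)) :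
    inv (w * longest n) + inv w = inv (longest n) := by
  rw [← inv_inv (w * longest n), mul_inv_rev, longest_inv, ← inv_inv w, inv_longest_mul]

theorem inv_longest : inv (longest n) = n * (n - 1) / 2 := by
  have h1 : inversions (longest n) = Finset.univ.filter fun p ↦ p.1 < p.2 := by
    ext ⟨i, j⟩
    simp [inversions, longest]
  rw [inv, h1, ← Finset.sum_range_id, Finset.card_filter, ← Finset.univ_product_univ,
    Finset.sum_product_right, ← Fin.sum_univ_eq_sum_range (fun i ↦ i)]
  refine Finset.sum_congr rfl fun j _ ↦ ?_
  rw [← Finset.card_filter, ← Fin.card_Iio]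
  congr 1
  ext i
  simp

end Inversions

/-! ### Words in the generators of a nilCoxeter monoid -/

section Matsumoto

variable {n : ℕ} {M : Type*} [MonoidWithZero M] {ψ : Fin (n - 1) → M}

theorem simple_comm {r k : Fin (n - 1)} (h : k.1 + 1 < r.1) :
    simple r * simple k = simple k * simple r := by
  refine Equiv.Perm.Disjoint.commute fun i ↦ ?_
  have e1 : (lo r).1 = r.1 := rfl
  have e2 : (hi r).1 = r.1 + 1 := rfl
  have e3 : (lo k).1 = k.1 := rfl
  have e4 : (hi k).1 = k.1 + 1 := rfl
  by_cases hi' : i.1 ≤ k.1 + 1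
  · left
    apply simple_of_ne <;> rw [Ne, Fin.ext_iff] <;> omega
  · right
    apply simple_of_ne <;> rw [Ne, Fin.ext_iff] <;> omega

theorem length_of_append_singleton {l : List (Fin (n - 1))} {r : Fin (n - 1)}
    (h : (l ++ [r]).length = inv (wordProd (l ++ [r]))) :
    l.length = inv (wordProd l) ∧
      wordProd (l ++ [r]) (hi r) < wordProd (l ++ [r]) (lo r) := by
  have h1 := inv_wordProd_le l
  rw [wordProd_append, wordProd_singleton, List.length_append, List.length_singleton] at h
  rw [wordProd_append, wordProd_singleton]
  simp only [Equiv.Perm.mul_apply, simple_lo, simple_hi]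
  rcases lt_or_gt_of_ne ((wordProd l).injective.ne (lo_lt_hi r).ne) with h2 | h2
  · have := inv_mul_simple_of_lt h2
    exact ⟨by omega, h2⟩
  · have := inv_mul_simple_of_gt h2
    omega

theorem prod_append_singleton (ψ : Fin (n - 1) → M) (l : List (Fin (n - 1))) (r : Fin (n - 1)) :
    ((l ++ [r]).map ψ).prod = (l.map ψ).prod * ψ r := by
  simp

/-- Two reduced words of the same permutation define the same product. -/
theorem prod_map_eq_of_reduced
    (comm : ∀ r k : Fin (n - 1), k.1 + 1 < r.1 → ψ r * ψ k = ψ k * ψ r)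
    (braid : ∀ r r' : Fin (n - 1), r'.1 = r.1 + 1 → ψ r * ψ r' * ψ r = ψ r' * ψ r * ψ r')
    (l l' : List (Fin (n - 1))) (hl : l.length = inv (wordProd l))
    (hl' : l'.length = inv (wordProd l')) (hll : wordProd l = wordProd l') :
    (l.map ψ).prod = (l'.map ψ).prod := by
  induction hk : l.length using Nat.strong_induction_on generalizing l l' with
  | _ k ih =>
  induction l using List.reverseRecOn with
  | nil =>
    have : l' = [] := by
      rw [← List.length_eq_zero_iff, hl', ← hll, ← hl, List.length_nil]
    rw [this]
  | append_singleton m r _ =>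
  induction l' using List.reverseRecOn with
  | nil => rw [← hll, ← hl] at hl'; simp at hl'
  | append_singleton m' r' _ =>
  obtain ⟨hm, hr⟩ := length_of_append_singleton hl
  obtain ⟨hm', hr'⟩ := length_of_append_singleton hl'
  have hlm : m.length + 1 = k := by simpa using hk
  have hlm' : m'.length + 1 = k := by
    rw [← hk, hl, hll, ← hl']; simp
  set w := wordProd (m ++ [r]) with hw
  have hwm : wordProd m = w * simple r := by
    rw [hw, wordProd_append, wordProd_singleton, mul_assoc, simple_mul_self, mul_one]
  have hwm' : wordProd m' = w * simple r' := by
    rw [hll, wordProd_append, wordProd_singleton, mul_assoc, simple_mul_self, mul_one]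
  rw [← hll] at hr'
  rw [prod_append_singleton, prod_append_singleton]
  -- the case `r < r'`, for arbitrary words
  have main : ∀ (m m' : List (Fin (n - 1))) (r r' : Fin (n - 1)), r.1 < r'.1 →
      m.length = inv (wordProd m) → m'.length = inv (wordProd m') →
      w (hi r) < w (lo r) → w (hi r') < w (lo r') → m.length + 1 = k → m'.length + 1 = k →
      wordProd m = w * simple r → wordProd m' = w * simple r' →
      (m.map ψ).prod * ψ r = (m'.map ψ).prod * ψ r' := by
    clear! m m' r r'
    intro m m' r r' hlt hm hm' hr hr' hlm hlm' hwm hwm'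
    have e1 : (lo r).1 = r.1 := rfl
    have e2 : (hi r).1 = r.1 + 1 := rfl
    have e3 : (lo r').1 = r'.1 := rfl
    have e4 : (hi r').1 = r'.1 + 1 := rfl
    have i1 := inv_mul_simple_of_gt hr
    rcases Nat.lt_or_ge (r.1 + 1) r'.1 with hfar | hnear
    · have i2 : inv (w * simple r * simple r') + 1 = inv (w * simple r) := by
        apply inv_mul_simple_of_gt
        rw [Equiv.Perm.mul_apply, Equiv.Perm.mul_apply,
          simple_of_ne (by rw [Ne, Fin.ext_iff]; omega) (by rw [Ne, Fin.ext_iff]; omega),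
          simple_of_ne (by rw [Ne, Fin.ext_iff]; omega) (by rw [Ne, Fin.ext_iff]; omega)]
        exact hr'
      -- Both commuting descents are stripped from `w`. By induction `m` may be replaced by `x r'`
      -- and `m'` by `x r`, so the two words differ by one commutation.
      obtain ⟨x, hx, hxl⟩ := exists_word_length_eq_inv (w * simple r * simple r')
      have p1 : wordProd (x ++ [r']) = w * simple r := by
        rw [wordProd_append, wordProd_singleton, hx, mul_assoc, simple_mul_self, mul_one]
      have p2 : wordProd (x ++ [r]) = w * simple r' := by
        rw [wordProd_append, wordProd_singleton, hx, mul_assoc w, ← simple_comm hfar, mul_assoc,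
          mul_assoc, simple_mul_self, mul_one]
      rw [ih m.length (by omega) m (x ++ [r']) hm (by rw [p1]; simp; omega) (by rw [p1, hwm]) rfl,
        ih m'.length (by omega) m' (x ++ [r]) hm'
          (by rw [p2, ← hwm', ← hm']; simp; rw [hwm] at hm; omega) (by rw [p2, hwm']) rfl,
        prod_append_singleton, prod_append_singleton, mul_assoc, mul_assoc, comm r' r hfar]
    · have hrr : r'.1 = r.1 + 1 := by omega
      have elo : lo r' = hi r := Fin.ext (by omega)
      have i2 : inv (w * simple r * simple r') + 1 = inv (w * simple r) := by
        apply inv_mul_simple_of_gt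
        rw [Equiv.Perm.mul_apply, Equiv.Perm.mul_apply, elo, simple_hi,
          simple_of_ne (by rw [Ne, Fin.ext_iff]; omega) (by rw [Ne, Fin.ext_iff]; omega)]
        rw [elo] at hr'
        exact hr'.trans hr
      have i3 : inv (w * simple r * simple r' * simple r) + 1
          = inv (w * simple r * simple r') := by
        apply inv_mul_simple_of_gt
        rw [Equiv.Perm.mul_apply, Equiv.Perm.mul_apply, Equiv.Perm.mul_apply,
          Equiv.Perm.mul_apply, ← elo, simple_lo,
          simple_of_ne (r := r) (i := hi r') (by rw [Ne, Fin.ext_iff]; omega)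
            (by rw [Ne, Fin.ext_iff]; omega),
          simple_of_ne (r := r') (i := lo r) (by rw [Ne, Fin.ext_iff]; omega)
            (by rw [Ne, Fin.ext_iff]; omega), simple_lo, ← elo]
        exact hr'
      have hbraid : simple r * simple r' * simple r = simple r' * simple r * simple r' := by
        have hne1 : lo r ≠ lo r' := by rw [Ne, Fin.ext_iff]; omega
        have hne2 : lo r ≠ hi r' := by rw [Ne, Fin.ext_iff]; omega
        have hne3 : lo r' ≠ hi r' := (lo_lt_hi r').ne
        unfold simple
        rw [← elo]
        rw [Equiv.swap_mul_swap_mul_swap hne1 hne2, Equiv.swap_comm (lo r),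
          Equiv.swap_comm (lo r') (hi r'), Equiv.swap_mul_swap_mul_swap hne3.symm hne2.symm,
          Equiv.swap_comm]
      -- Here the longest element of the subgroup generated by `s_r` and `s_{r'}` is stripped from
      -- `w`; the replaced words then differ by one braid move.
      obtain ⟨x, hx, hxl⟩ := exists_word_length_eq_inv (w * simple r * simple r' * simple r)
      have p1 : wordProd (x ++ [r] ++ [r']) = w * simple r := by
        simp only [wordProd_append, wordProd_singleton, hx, mul_assoc, simple_mul_self, mul_one]
      have p2 : wordProd (x ++ [r'] ++ [r]) = w * simple r' := by
        rw [wordProd_append, wordProd_append, wordProd_singleton, wordProd_singleton, hx,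
          mul_assoc w, mul_assoc w, hbraid]
        simp only [mul_assoc]
        rw [← mul_assoc (simple r') (simple r'), simple_mul_self, one_mul, simple_mul_self,
          mul_one]
      rw [ih m.length (by omega) m (x ++ [r] ++ [r']) hm (by rw [p1]; simp; omega)
          (by rw [p1, hwm]) rfl,
        ih m'.length (by omega) m' (x ++ [r'] ++ [r]) hm'
          (by rw [p2, ← hwm', ← hm']; simp; rw [hwm] at hm; omega) (by rw [p2, hwm']) rfl]
      simp only [prod_append_singleton, mul_assoc]
      rw [← mul_assoc (ψ r), ← mul_assoc (ψ r'), braid r r' hrr]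
  rcases lt_trichotomy r.1 r'.1 with h | h | h
  · exact main m m' r r' h hm hm' hr hr' hlm hlm' hwm hwm'
  · obtain rfl : r = r' := Fin.ext h
    rw [ih m.length (by omega) m m' hm hm' (by rw [hwm, hwm']) rfl]
  · exact (main m' m r' r h hm' hm hr' hr hlm' hlm hwm' hwm).symm

/-- A word which is not reduced defines the product zero. -/
theorem prod_map_eq_zero (sq : ∀ r : Fin (n - 1), ψ r * ψ r = 0)
    (comm : ∀ r k : Fin (n - 1), k.1 + 1 < r.1 → ψ r * ψ k = ψ k * ψ r)
    (braid : ∀ r r' : Fin (n - 1), r'.1 = r.1 + 1 → ψ r * ψ r' * ψ r = ψ r' * ψ r * ψ r')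
    (l : List (Fin (n - 1))) (hl : l.length ≠ inv (wordProd l)) : (l.map ψ).prod = 0 := by
  induction l using List.reverseRecOn with
  | nil => simp [wordProd, inv_one] at hl
  | append_singleton l r ih =>
    rw [prod_append_singleton]
    by_cases h : l.length = inv (wordProd l)
    · have hd : wordProd l (hi r) < wordProd l (lo r) := by
        refine lt_of_le_of_ne (not_lt.1 fun h' ↦ hl ?_) ((wordProd l).injective.ne (lo_lt_hi r).ne')
        rw [wordProd_append, wordProd_singleton, inv_mul_simple_of_lt h', ← h]
        simp
      -- Since `r` is a descent of the reduced word `l`, some reduced word of the same permutation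
      -- ends in `r`, and `ψ_r²` appears.
      obtain ⟨x, hx, hxl⟩ := exists_word_length_eq_inv (wordProd l * simple r)
      have hp : wordProd (x ++ [r]) = wordProd l := by
        rw [wordProd_append, wordProd_singleton, hx, mul_assoc, simple_mul_self, mul_one]
      rw [prod_map_eq_of_reduced comm braid l (x ++ [r]) h ?_ hp.symm, prod_append_singleton,
        mul_assoc, sq, mul_zero]
      rw [hp, List.length_append, hxl, List.length_singleton, inv_mul_simple_of_gt hd]
    · rw [ih h, zero_mul]

end Matsumoto

/-! ### Polynomials are spanned by `n!` elements over the symmetric polynomials -/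

section Spanning

universe u

open Polynomial

/-- Adjoin the roots one by one: `R[y_0]` is spanned by `deg q` powers of `y_0`, and `q / (X - y_0)`
is monic over it with the remaining roots. The induction replaces `R` by this subring of `B`, whence
the common universe. -/
theorem exists_span_adjoin_range {n : ℕ} {R B : Type u} [CommRing R] [CommRing B] [Algebra R B]
    (y : Fin n → B) (q : R[X]) (hq : q.Monic)
    (h : q.map (algebraMap R B) = ∏ j, (X - C (y j))) :
    ∃ m : Fin (n !) → B, Subalgebra.toSubmodule (Algebra.adjoin R (Set.range y)) ≤
      Submodule.span R (Set.range m) := by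
  classical
  induction n generalizing R with
  | zero =>
    refine ⟨fun _ ↦ 1, ?_⟩
    rw [Set.range_eq_empty, Algebra.adjoin_empty, Algebra.toSubmodule_bot, Submodule.one_eq_span]
    refine Submodule.span_mono ?_
    rintro _ rfl
    exact ⟨⟨0, Nat.one_pos⟩, rfl⟩
  | succ n ih =>
    rcases subsingleton_or_nontrivial B with hB | hB
    · exact ⟨fun _ ↦ 0, fun x _ ↦ by rw [Subsingleton.elim x 0]; exact zero_mem _⟩
    let S := Algebra.adjoin R {y 0}
    let c : S := ⟨y 0, Algebra.self_mem_adjoin_singleton R _⟩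
    have hroot : aeval (y 0) q = 0 := by
      rw [aeval_def, ← eval_map, h, eval_prod]
      exact Finset.prod_eq_zero (Finset.mem_univ 0) (by simp)
    have hdeg : q.natDegree = n + 1 := by
      rw [← hq.natDegree_map (algebraMap R B), h, natDegree_finsetProd_X_sub_C_eq_card]
      simp
    let q' : S[X] := q.map (algebraMap R S) /ₘ (X - C c)
    have hq' : (X - C c) * q' = q.map (algebraMap R S) := by
      refine mul_divByMonic_eq_iff_isRoot.2 ?_
      rw [IsRoot, eval_map, ← aeval_def]
      apply Subtype.val_injective
      have := aeval_algHom_apply S.val c q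
      rw [Subalgebra.coe_val] at this
      rw [← this]
      exact hroot
    have hmap : q'.map (algebraMap S B) = ∏ j : Fin n, (X - C (y j.succ)) := by
      have h1 := congrArg (Polynomial.map (algebraMap S B)) hq'
      rw [Polynomial.map_map, ← IsScalarTower.algebraMap_eq, h, Fin.prod_univ_succ,
        Polynomial.map_mul, Polynomial.map_sub, map_X, map_C] at h1
      -- `B` may have zero divisors, but a monic factor can always be cancelled.
      exact (monic_X_sub_C (y 0)).isRegular.left h1
    have hmonic : q'.Monic := by
      refine monic_of_injective (f := algebraMap S B) Subtype.val_injective ?_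
      rw [hmap]
      exact monic_prod_of_monic _ _ fun j _ ↦ monic_X_sub_C _
    obtain ⟨m, hm⟩ := ih (fun j ↦ y j.succ) q' hmonic hmap
    have hcard : Fintype.card (Fin ((n + 1)!)) = Fintype.card (Fin (n !) × Fin (n + 1)) := by
      simp [Nat.factorial_succ, mul_comm]
    let e := Fintype.equivOfCardEq hcard
    refine ⟨fun i ↦ y 0 ^ (e i).2.1 * m (e i).1, fun b hb ↦ ?_⟩
    have hb' : b ∈ Algebra.adjoin S (Set.range fun j : Fin n ↦ y j.succ) := by
      have hy : Set.range y = {y 0} ∪ Set.range fun j : Fin n ↦ y j.succ := by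
        ext b
        simp [Fin.exists_fin_succ, eq_comm]
      rw [hy, Algebra.adjoin_union_eq_adjoin_adjoin] at hb
      exact hb
    obtain ⟨s, rfl⟩ := (Submodule.mem_span_range_iff_exists_fun S).1 (hm hb')
    refine Submodule.sum_mem _ fun i _ ↦ ?_
    have hs : (s i : B) ∈ Submodule.span R
        (Finset.image (y 0 ^ ·) (Finset.range q.natDegree) : Set B) := by
      rw [Submodule.span_range_natDegree_eq_adjoin hq hroot]
      exact (s i).2
    have hle : Submodule.span R (Finset.image (y 0 ^ ·) (Finset.range q.natDegree) : Set B) ≤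
        (Submodule.span R (Set.range fun i ↦ y 0 ^ (e i).2.1 * m (e i).1)).comap
          (LinearMap.mulRight R (m i)) := by
      rw [Submodule.span_le]
      intro x hx
      obtain ⟨k, hk, rfl⟩ := Finset.mem_image.1 (Finset.mem_coe.1 hx)
      rw [hdeg, Finset.mem_range] at hk
      refine Submodule.subset_span ⟨e.symm (i, ⟨k, hk⟩), ?_⟩
      simp
    exact hle hs

/-- The polynomial `∏ (T - X_j)` has symmetric coefficients, so it descends to the symmetric
subalgebra and the splitting argument applies. -/
theorem exists_symmetric_span (K : Type u) [Field K] (n : ℕ) :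
    ∃ m : Fin (n !) → MvPolynomial (Fin n) K, ∀ f, ∃ s : Fin (n !) → MvPolynomial (Fin n) K,
      (∀ i, (s i).IsSymmetric) ∧ f = ∑ i, s i * m i := by
  let A := MvPolynomial.symmetricSubalgebra (Fin n) K
  have hlift : (∏ j : Fin n, (X - C (MvPolynomial.X j : MvPolynomial (Fin n) K))) ∈
      lifts (algebraMap A (MvPolynomial (Fin n) K)) := by
    rw [lifts_iff_coeff_lifts]
    intro k
    refine ⟨⟨(∏ j : Fin n, (X - C (MvPolynomial.X j : MvPolynomial (Fin n) K))).coeff k, ?_⟩, rfl⟩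
    rw [MvPolynomial.mem_symmetricSubalgebra]
    intro σ
    rw [← AlgHom.coe_toRingHom, ← coeff_map, Polynomial.map_prod]
    congr 1
    rw [← Equiv.prod_comp σ (fun j ↦ X - C (MvPolynomial.X j : MvPolynomial (Fin n) K))]
    exact Finset.prod_congr rfl fun j _ ↦ by simp
  obtain ⟨q, hq, -, hmonic⟩ := lifts_and_natDegree_eq_and_monic hlift
    (monic_prod_of_monic _ _ fun j _ ↦ monic_X_sub_C _)
  obtain ⟨m, hm⟩ := exists_span_adjoin_range _ q hmonic hq
  refine ⟨m, fun f ↦ ?_⟩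
  have hf : f ∈ Algebra.adjoin A (Set.range (MvPolynomial.X : Fin n → MvPolynomial (Fin n) K)) := by
    have : (⊤ : Subalgebra K (MvPolynomial (Fin n) K)) ≤
        (Algebra.adjoin A (Set.range MvPolynomial.X)).restrictScalars K := by
      rw [← MvPolynomial.adjoin_range_X]
      exact Algebra.adjoin_le Algebra.subset_adjoin
    exact this trivial
  obtain ⟨s, hs⟩ := (Submodule.mem_span_range_iff_exists_fun A).1 (hm hf)
  exact ⟨fun i ↦ s i, fun i ↦ (s i).2, hs.symm⟩

end Spanning

/-! ### Polynomials in the `y_k` -/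

namespace NilRel

variable {K R : Type*} [Field K] [Ring R] [Algebra K R] {n : ℕ} {ψ y : ℕ → R}

open scoped IsMulCommutative in
theorem exists_polynomial_map (H : NilRel n ψ y) :
    ∃ Φ : MvPolynomial (Fin n) K →ₐ[K] R, ∀ k : Fin n, Φ (MvPolynomial.X k) = y k := by
  let s : Set R := Set.range fun k : Fin n ↦ y k
  have hs : ∀ a ∈ s, ∀ b ∈ s, a * b = b * a := by
    rintro _ ⟨i, rfl⟩ _ ⟨j, rfl⟩
    exact H.y_comm i j i.2 j.2
  have := Algebra.isMulCommutative_adjoin K hs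
  exact ⟨(Algebra.adjoin K s).val.comp
    (MvPolynomial.aeval (S₁ := Algebra.adjoin K s) fun k : Fin n ↦
      ⟨y k, Algebra.subset_adjoin ⟨k, rfl⟩⟩), fun k ↦ by simp⟩

variable {Φ : MvPolynomial (Fin n) K →ₐ[K] R}

/-- The generator `ψ_r` moves past a polynomial `f` up to the divided difference `g` of `f`. -/
theorem psi_mul_polynomial (H : NilRel n ψ y)
    (hΦ : ∀ k : Fin n, Φ (MvPolynomial.X k) = y k) (r : Fin (n - 1)) (f : MvPolynomial (Fin n) K) :
    ∃ g, ψ r * Φ f = Φ (MvPolynomial.rename (simple r) f) * ψ r + Φ g ∧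
      (MvPolynomial.X (hi r) - MvPolynomial.X (lo r)) * g =
        f - MvPolynomial.rename (simple r) f := by
  have hr : r.1 + 1 < n := by omega
  induction f using MvPolynomial.induction_on with
  | C c =>
    refine ⟨0, ?_, by simp⟩
    rw [MvPolynomial.rename_C, map_zero, add_zero, ← MvPolynomial.algebraMap_eq, AlgHom.commutes]
    exact (Algebra.commutes _ _).symm
  | add f₁ f₂ h₁ h₂ =>
    obtain ⟨g₁, h₁, h₁'⟩ := h₁
    obtain ⟨g₂, h₂, h₂'⟩ := h₂
    refine ⟨g₁ + g₂, ?_, ?_⟩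
    · simp only [map_add, mul_add, add_mul, h₁, h₂]
      abel
    · rw [mul_add, h₁', h₂', map_add]
      ring
  | mul_X f k h =>
    obtain ⟨g, h, h'⟩ := h
    have hX : ∃ g₂ : MvPolynomial (Fin n) K,
        ψ r * y k = y (simple r k) * ψ r + Φ g₂ ∧
          (MvPolynomial.X (hi r) - MvPolynomial.X (lo r)) * g₂ =
            MvPolynomial.X k - MvPolynomial.X (simple r k) := by
      by_cases h₁ : k = lo r
      · refine ⟨-1, ?_, ?_⟩
        · rw [h₁, simple_lo, map_neg, map_one, ← sub_eq_add_neg]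
          exact H.psi_y_self hr
        · rw [h₁, simple_lo]
          ring
      · by_cases h₂ : k = hi r
        · refine ⟨1, ?_, ?_⟩
          · rw [h₂, simple_hi, map_one]
            exact H.psi_y r hr
          · rw [h₂, simple_hi, mul_one]
        · refine ⟨0, ?_, ?_⟩
          · rw [simple_of_ne h₁ h₂, map_zero, add_zero]
            exact H.psi_y_comm r k hr k.2 (fun h ↦ h₁ (Fin.ext h)) (fun h ↦ h₂ (Fin.ext h))
          · rw [simple_of_ne h₁ h₂, mul_zero, sub_self]
    obtain ⟨g₂, e, e'⟩ := hX
    -- The twisted Leibniz rule `∂(f X_k) = s_r(f) ∂(X_k) + ∂(f) X_k`.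
    refine ⟨MvPolynomial.rename (simple r) f * g₂ + g * MvPolynomial.X k, ?_, ?_⟩
    · simp only [map_mul, map_add, MvPolynomial.rename_X, hΦ]
      rw [← mul_assoc, h, add_mul, mul_assoc _ (ψ r), e, mul_add, mul_assoc, ← add_assoc]
    · rw [map_mul, MvPolynomial.rename_X, mul_add, mul_left_comm, e', ← mul_assoc, h']
      ring

/-- The divided difference of a symmetric polynomial vanishes; the cancellation takes place in the
polynomial ring, which is a domain, before `Φ` is applied. -/
theorem commute_psi_of_isSymmetric (H : NilRel n ψ y)
    (hΦ : ∀ k : Fin n, Φ (MvPolynomial.X k) = y k) (r : Fin (n - 1))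
    {f : MvPolynomial (Fin n) K} (hf : f.IsSymmetric) : ψ r * Φ f = Φ f * ψ r := by
  obtain ⟨g, h, h'⟩ := H.psi_mul_polynomial hΦ r f
  rw [hf (simple r), sub_self, mul_eq_zero, sub_eq_zero, MvPolynomial.X_inj] at h'
  rw [h, hf (simple r), h'.resolve_left (lo_lt_hi r).ne', map_zero, add_zero]

theorem exists_psi_mul_polynomial_mul (H : NilRel n ψ y)
    (hΦ : ∀ k : Fin n, Φ (MvPolynomial.X k) = y k) (r : Fin (n - 1))
    (f : MvPolynomial (Fin n) K) : ∃ g, ψ r * Φ f * stair ψ n = Φ g * stair ψ n := by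
  obtain ⟨g, h, -⟩ := H.psi_mul_polynomial hΦ r f
  refine ⟨g, ?_⟩
  rw [h, add_mul, mul_assoc, H.psi_mul_stair le_rfl (by omega), mul_zero, zero_add]

end NilRel

/-! ### Systems of matrix units -/

section MatrixUnits

variable {ι : Type*} [Fintype ι] [DecidableEq ι]

/-- Orthogonalization of a unitriangular system. -/
theorem mul_eq_of_unitriangular {R : Type*} [Ring R] {N : ℕ} {a b : Fin N → R} {p t : R}
    {f : Fin N → Fin N → R}
    (hdiag : ∀ i, p * t * b i * a i * t * p = p)
    (hzero : ∀ i j, i < j → p * t * b j * a i * t * p = 0)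
    (hf : ∀ i j, f i j = a i * t * p * t * b j -
      ∑ k : {k : Fin N // k < i}, f k.1 k.1 * (a i * t * p * t * b j)) (i j k l : Fin N) :
    f i j * f k l = if j = k then f i l else 0 := by
  let q : Fin N → R := fun i ↦ (1 - ∑ k : {k : Fin N // k < i}, f k.1 k.1) * a i * t
  have hfq : ∀ i j, f i j = q i * p * t * b j := by
    intro i j
    rw [hf, ← Finset.sum_mul]
    simp only [q]
    noncomm_ring
  -- The corrected left factors `q i` are dual to the `b j`. For `j < i` the subtracted sum
  -- contributes exactly the unwanted entry, through its term `k = j`; for `j ≥ i` it contributes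
  -- nothing.
  have key : ∀ i j, p * t * b j * q i * p = if j = i then p else 0 := by
    intro i
    induction i using WellFoundedLT.induction with
    | _ i ih =>
    intro j
    have hS : p * t * b j * (∑ k : {k : Fin N // k < i}, f k.1 k.1) * (a i * t * p) =
        if j < i then p * t * b j * a i * t * p else 0 := by
      rw [Finset.mul_sum, Finset.sum_mul]
      have : ∀ k : {k : Fin N // k < i}, p * t * b j * f k.1 k.1 * (a i * t * p) =
          if j = k.1 then p * t * b j * a i * t * p else 0 := by
        intro k
        have h := ih k.1 k.2 j
        rw [hfq]
        calc p * t * b j * (q k * p * t * b k) * (a i * t * p)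
            = (p * t * b j * q k * p) * t * b k * a i * t * p := by simp only [mul_assoc]
          _ = _ := by
            rw [h]
            split_ifs with hjk
            · rw [hjk]
            · simp
      rw [Finset.sum_congr rfl fun k _ ↦ this k]
      split_ifs with hji
      · rw [Finset.sum_eq_single (⟨j, hji⟩ : {k : Fin N // k < i})]
        · simp
        · intro k _ hk
          exact if_neg fun h ↦ hk (Subtype.ext h.symm)
        · simp
      · refine Finset.sum_eq_zero fun k _ ↦ if_neg ?_
        rintro rfl
        exact hji k.2
    have hq : p * t * b j * q i * p = p * t * b j * a i * t * p -
        p * t * b j * (∑ k : {k : Fin N // k < i}, f k.1 k.1) * (a i * t * p) := by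
      simp only [q]
      noncomm_ring
    rw [hq, hS]
    rcases lt_trichotomy j i with h | rfl | h
    · rw [if_pos h, if_neg h.ne, sub_self]
    · rw [if_neg (lt_irrefl _), if_pos rfl, sub_zero, hdiag]
    · rw [if_neg h.not_gt, if_neg h.ne', sub_zero, hzero i j h]
  calc f i j * f k l = q i * (p * t * b j * q k * p) * t * b l := by
        rw [hfq, hfq]; simp only [mul_assoc]
    _ = _ := by
        rw [key]
        split_ifs with h
        · rw [hfq]
        · simp

/-- A system of matrix units is complete if its corner `e R e` is commutative, `R e` is spanned
over the center by as many elements as there are diagonal units, and `R e R = R`. -/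
theorem sum_eq_one_of_span {R : Type*} [Ring R] {f : ι → ι → R}
    (hf : ∀ i j k l, f i j * f k l = if j = k then f i l else 0) (o : ι)
    (hcomm : ∀ x x', f o o * x * f o o * (f o o * x' * f o o) =
      f o o * x' * f o o * (f o o * x * f o o))
    (m : ι → R)
    (hm : ∀ h, ∃ s : ι → R, (∀ i x, s i * x = x * s i) ∧ h * f o o = ∑ i, m i * f o o * s i)
    (hfaithful : ∀ d, (∀ h, d * h * f o o = 0) → d = 0) : ∑ i, f i i = 1 := by
  have he : IsIdempotentElem (f o o) := by rw [IsIdempotentElem, hf, if_pos rfl]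
  have he' : f o o * f o o = f o o := he
  have hmem : ∀ x : R, f o o * x * f o o ∈ Subsemigroup.corner (f o o) := fun x ↦ ⟨x, rfl⟩
  let _ : CommRing he.Corner :=
    { (inferInstance : Ring he.Corner) with
      mul_comm := by
        rintro ⟨_, ⟨x, rfl⟩⟩ ⟨_, ⟨x', rfl⟩⟩
        exact Subtype.ext (hcomm x x') }
  choose s hs hsum using hm
  -- With `e = f o o`, `S` holds the coordinates of `m a * e` against the units `f j o`, and `T` the
  -- coefficients of `f i o` in the spanning elements `m a * e`. `S * T = 1` restates `f o j * f i o
  -- = δ e`.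
  let S : Matrix ι ι he.Corner := fun j a ↦ ⟨f o o * (f o j * m a) * f o o, hmem _⟩
  let T : Matrix ι ι he.Corner := fun a i ↦ ⟨f o o * s (f i o) a * f o o, hmem _⟩
  have hval : ∀ (A B : Matrix ι ι he.Corner) (i j : ι),
      ((A * B) i j : he.Corner).1 = ∑ k, (A i k).1 * (B k j).1 := by
    intro A B i j
    rw [Matrix.mul_apply]
    exact map_sum (⟨⟨Subtype.val, rfl⟩, fun _ _ ↦ rfl⟩ : he.Corner →+ R) _ _
  have hone : ∀ i j : ι, ((1 : Matrix ι ι he.Corner) i j).1 = if i = j then f o o else 0 := by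
    intro i j
    rw [Matrix.one_apply]
    split_ifs <;> rfl
  have hST : S * T = 1 := by
    refine Matrix.ext fun j i ↦ Subtype.ext ?_
    rw [hval, hone]
    have h1 : ∀ a, (S j a).1 * (T a i).1 = f o j * (m a * f o o * s (f i o) a) * f o o := by
      intro a
      simp only [S, T]
      calc _ = (f o o * f o j) * m a * (f o o * f o o) * s (f i o) a * f o o := by
            simp only [mul_assoc]
        _ = _ := by rw [he', hf, if_pos rfl]; simp only [mul_assoc]
    rw [Finset.sum_congr rfl fun a _ ↦ h1 a, ← Finset.sum_mul, ← Finset.mul_sum, ← hsum,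
      ← mul_assoc, hf, mul_assoc, he', ite_mul, zero_mul, he']
  -- This replaces the dimension count: the matrices are square over a commutative ring.
  have hTS : T * S = 1 := mul_eq_one_comm.1 hST
  have hE : ∀ a, (∑ i, f i i) * (m a * f o o) = m a * f o o := by
    intro a
    have h1 : ∀ i, f i i * (m a * f o o) = ∑ c, m c * ((T c i).1 * (S i a).1) := by
      intro i
      have h2 : ∀ c, m c * ((T c i).1 * (S i a).1) =
          (m c * f o o * s (f i o) c) * (f o o * f o i * m a * f o o) := by
        intro c
        simp only [S, T]
        calc _ = m c * (f o o * s (f i o) c * (f o o * f o o)) * f o i * m a * f o o := by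
              simp only [mul_assoc]
          _ = _ := by rw [he']; simp only [mul_assoc]
      rw [Finset.sum_congr rfl fun c _ ↦ h2 c, ← Finset.sum_mul, ← hsum]
      simp only [hf, if_true, ← mul_assoc]
    rw [Finset.sum_mul, Finset.sum_congr rfl fun i _ ↦ h1 i, Finset.sum_comm]
    have h3 : ∀ c, ∑ i, m c * ((T c i).1 * (S i a).1) = m c * if c = a then f o o else 0 := by
      intro c
      rw [← Finset.mul_sum, ← hval, hTS, hone]
    rw [Finset.sum_congr rfl fun c _ ↦ h3 c]
    simp
  refine (sub_eq_zero.1 (hfaithful _ fun h ↦ ?_)).symm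
  rw [mul_assoc, hsum, Finset.mul_sum]
  refine Finset.sum_eq_zero fun a _ ↦ ?_
  rw [← mul_assoc, sub_mul, hE, one_mul, sub_self, zero_mul]

variable {K R : Type*} [Field K] [Ring R] [Algebra K R] {f : ι → ι → R}

/-- The coefficient of `x` at the matrix unit `f i j`. -/
def unitCoeff (f : ι → ι → R) (x : R) (i j : ι) : R := ∑ k, f k i * x * f j k

theorem unitCoeff_commute (hf : ∀ i j k l, f i j * f k l = if j = k then f i l else 0)
    (x : R) (i j k l : ι) : unitCoeff f x i j * f k l = f k l * unitCoeff f x i j := by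
  simp only [unitCoeff, Finset.sum_mul, Finset.mul_sum]
  simp only [mul_assoc, hf]
  simp only [← mul_assoc, hf]
  simp

theorem sum_mul_unitCoeff (hf : ∀ i j k l, f i j * f k l = if j = k then f i l else 0)
    (hone : ∑ i, f i i = 1) (x : R) : ∑ i, ∑ j, f i j * unitCoeff f x i j = x := by
  have : ∀ i j, f i j * unitCoeff f x i j = f i i * x * f j j := by
    intro i j
    simp only [unitCoeff, Finset.mul_sum, ← mul_assoc, hf]
    simp
  simp only [this, ← Finset.mul_sum, ← Finset.sum_mul, hone, one_mul, mul_one]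

/-- If the corner of one matrix unit is commutative, any two elements which commute with all
matrix units commute with each other. -/
theorem mul_comm_of_commute_units (hf : ∀ i j k l, f i j * f k l = if j = k then f i l else 0)
    (hone : ∑ i, f i i = 1) (o : ι)
    (hcomm : ∀ x x', f o o * x * f o o * (f o o * x' * f o o) =
      f o o * x' * f o o * (f o o * x * f o o))
    {c d : R} (hc : ∀ i j, c * f i j = f i j * c) (hd : ∀ i j, d * f i j = f i j * d) :
    c * d = d * c := by
  -- On the centralizer of the units, `c ↦ e c` is multiplicative into the commutative corner. It
  -- loses nothing, because `f k o` and `f o k` transport the corner to every `f k k` and these sum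
  -- to `1`.
  have h0 : ∀ {c d : R}, (∀ i j, c * f i j = f i j * c) → (∀ i j, d * f i j = f i j * d) →
      f o o * (c * d) = f o o * c * f o o * (f o o * d * f o o) := by
    intro c d hc hd
    have he : f o o * f o o = f o o := by rw [hf, if_pos rfl]
    have e : ∀ {c : R}, (∀ i j, c * f i j = f i j * c) → f o o * c * f o o = f o o * c := by
      intro c hc
      rw [mul_assoc, hc, ← mul_assoc, he]
    rw [e hc, e hd, ← mul_assoc (f o o * c), e hc, mul_assoc]
  have h1 : f o o * (c * d) = f o o * (d * c) := by rw [h0 hc hd, hcomm, ← h0 hd hc]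
  have h2 : ∀ k, (c * d) * f k k = (d * c) * f k k := by
    intro k
    have e1 : ∀ {c d : R}, (∀ i j, c * f i j = f i j * c) → (∀ i j, d * f i j = f i j * d) →
        c * d * f k k = f k o * (f o o * (c * d)) * f o k := by
      intro c d hc hd
      have e2 : c * d * f o k = f o k * (c * d) := by rw [mul_assoc, hd, ← mul_assoc, hc, mul_assoc]
      rw [mul_assoc (f k o), mul_assoc (f o o), e2, ← mul_assoc, ← mul_assoc, hf, if_pos rfl, hf,
        if_pos rfl, mul_assoc, hd, ← mul_assoc, hc, mul_assoc]
    rw [e1 hc hd, h1, ← e1 hd hc]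
  rw [← mul_one (c * d), ← hone, Finset.mul_sum, Finset.sum_congr rfl fun k _ ↦ h2 k,
    ← Finset.mul_sum, hone, mul_one]

/-- Any `b` is a combination of units with coefficients centralizing the units, and elements of that
centralizer commute with one another. -/
theorem unitCoeff_mem_center (hf : ∀ i j k l, f i j * f k l = if j = k then f i l else 0)
    (hone : ∑ i, f i i = 1) (o : ι)
    (hcomm : ∀ x x', f o o * x * f o o * (f o o * x' * f o o) =
      f o o * x' * f o o * (f o o * x * f o o)) (x : R) (i j : ι) :
    unitCoeff f x i j ∈ Subalgebra.center K R := by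
  rw [Subalgebra.mem_center_iff]
  intro b
  have hu := unitCoeff_commute hf
  rw [← sum_mul_unitCoeff hf hone b, Finset.sum_mul, Finset.mul_sum]
  refine Finset.sum_congr rfl fun k _ ↦ ?_
  rw [Finset.sum_mul, Finset.mul_sum]
  refine Finset.sum_congr rfl fun l _ ↦ ?_
  rw [mul_assoc, mul_comm_of_commute_units hf hone o hcomm (hu b k l) (hu x i j), ← mul_assoc,
    ← hu, mul_assoc]

/-- A complete system of matrix units with a commutative corner identifies the algebra with the
matrices over its center. -/
theorem exists_matrix_algEquiv (hf : ∀ i j k l, f i j * f k l = if j = k then f i l else 0)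
    (hone : ∑ i, f i i = 1) (o : ι)
    (hcomm : ∀ x x', f o o * x * f o o * (f o o * x' * f o o) =
      f o o * x' * f o o * (f o o * x * f o o)) :
    ∃ e : Matrix ι ι (Subalgebra.center K R) ≃ₐ[K] R,
      (∀ A, e A = ∑ i, ∑ j, f i j * (A i j : R)) ∧
        ∀ z : Subalgebra.center K R, e (Matrix.scalar ι z) = z := by
  have hz : ∀ (z : Subalgebra.center K R) (x : R), x * z = z * x :=
    fun z ↦ Subalgebra.mem_center_iff.1 z.2
  have hscalar : ∀ z : Subalgebra.center K R,
      ∑ i, ∑ j, f i j * ((Matrix.scalar ι z i j : Subalgebra.center K R) : R) = z := by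
    intro z
    have : ∀ i j, f i j * ((Matrix.scalar ι z i j : Subalgebra.center K R) : R) =
        if i = j then f i j * z else 0 := by
      intro i j
      rw [Matrix.scalar_apply, Matrix.diagonal_apply]
      split_ifs <;> simp
    simp only [this, Finset.sum_ite_eq, Finset.mem_univ, if_true, ← Finset.sum_mul, hone, one_mul]
  let F : Matrix ι ι (Subalgebra.center K R) →ₐ[K] R :=
    { toFun := fun A ↦ ∑ i, ∑ j, f i j * (A i j : R)
      map_one' := by
        rw [← map_one (Matrix.scalar ι)]
        exact hscalar 1
      map_mul' := by
        intro A B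
        have h1 : ∀ i j, f i j * (A i j : R) * (∑ k, ∑ l, f k l * (B k l : R)) =
            ∑ l, f i l * ((A i j : R) * B j l) := by
          intro i j
          have : ∀ k l, f i j * (A i j : R) * (f k l * (B k l : R)) =
              if j = k then f i l * ((A i j : R) * B j l) else 0 := by
            intro k l
            rw [mul_assoc, ← mul_assoc (A i j : R), ← hz, mul_assoc, ← mul_assoc, hf]
            split_ifs with h
            · rw [h]
            · rw [zero_mul]
          simp only [Finset.mul_sum, this]
          rw [Finset.sum_comm]
          simp
        rw [Finset.sum_mul]
        refine Finset.sum_congr rfl fun i _ ↦ ?_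
        rw [Finset.sum_mul, Finset.sum_congr rfl fun j _ ↦ h1 i j, Finset.sum_comm]
        refine Finset.sum_congr rfl fun l _ ↦ ?_
        rw [Matrix.mul_apply, AddSubmonoidClass.coe_finsetSum, Finset.mul_sum]
        rfl
      map_zero' := by simp
      map_add' := by
        intro A B
        simp only [← Finset.sum_add_distrib]
        refine Finset.sum_congr rfl fun i _ ↦ Finset.sum_congr rfl fun j _ ↦ ?_
        rw [Matrix.add_apply, ← mul_add]
        rfl
      commutes' := by
        intro c
        exact hscalar (algebraMap K _ c) }
  have hF : ∀ A, F A = ∑ i, ∑ j, f i j * (A i j : R) := fun _ ↦ rfl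
  have hcoeff : ∀ A i j, unitCoeff f (F A) i j = A i j := by
    intro A i j
    have h1 : ∀ k, f k i * F A * f j k = f k k * A i j := by
      intro k
      have h2 : ∀ a b, f k i * (f a b * (A a b : R)) * f j k =
          if i = a then (if b = j then f k k * A i j else 0) else 0 := by
        intro a b
        rw [← mul_assoc, hf]
        split_ifs with h3 h4
        · rw [mul_assoc, ← hz, ← mul_assoc, hf, if_pos h4, h3, h4]
        · rw [mul_assoc, ← hz, ← mul_assoc, hf, if_neg h4, zero_mul]
        · simp
      rw [hF, Finset.mul_sum, Finset.sum_mul]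
      simp only [Finset.mul_sum, Finset.sum_mul, h2]
      rw [Finset.sum_eq_single i]
      · simp
      · intro a _ ha
        simp [ha.symm]
      · simp
    rw [unitCoeff, Finset.sum_congr rfl fun k _ ↦ h1 k, ← Finset.sum_mul, hone, one_mul]
  refine ⟨AlgEquiv.ofBijective F ⟨fun A B h ↦ ?_, fun x ↦ ?_⟩, hF, hscalar⟩
  · ext i j
    rw [← hcoeff, h, hcoeff]
  · refine ⟨fun i j ↦ ⟨unitCoeff f x i j, unitCoeff_mem_center hf hone o hcomm x i j⟩, ?_⟩
    exact sum_mul_unitCoeff hf hone x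

end MatrixUnits

/-! ### The staircase word of the longest element -/

section StairWord

variable {n : ℕ}

/-- The extension by `1` to all indices of a family indexed by the generators. -/
def extendOne {M : Type*} [One M] {m : ℕ} (g : Fin m → M) (i : ℕ) : M :=
  if h : i < m then g ⟨i, h⟩ else 1

theorem extendOne_val {M : Type*} [One M] {m : ℕ} (g : Fin m → M) (i : Fin m) :
    extendOne g i = g i := dif_pos i.2

theorem extendOne_of_lt {M : Type*} [One M] {m : ℕ} (g : Fin m → M) {i : ℕ} (h : i < m) :
    extendOne g i = g ⟨i, h⟩ := dif_pos h

theorem map_extendOne {M N : Type*} [Monoid M] [Monoid N] (F : M →* N) {m : ℕ} (g : Fin m → M)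
    (i : ℕ) : F (extendOne g i) = extendOne (fun i ↦ F (g i)) i := by
  unfold extendOne
  split_ifs <;> simp

/-- The word `(s_0) (s_1 s_0) ⋯ (s_{n-2} ⋯ s_0)`. -/
def stairWord (n : ℕ) : List (Fin (n - 1)) := (stair (extendOne FreeMonoid.of) n).toList

theorem prod_map_stairWord {M : Type*} [Monoid M] (g : Fin (n - 1) → M) :
    ((stairWord n).map g).prod = stair (extendOne g) n := by
  rw [stairWord, ← FreeMonoid.lift_apply, map_stair]
  congr 1
  funext i
  rw [map_extendOne]
  simp

theorem length_stairWord : (stairWord n).length = n * (n - 1) / 2 := by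
  -- Sending every generator to `1 : ℕ` counts the letters.
  have h := prod_map_stairWord (n := n) fun _ ↦ Multiplicative.ofAdd (1 : ℕ)
  rw [List.map_const', List.prod_replicate, stair_eq_prod] at h
  have h' : ∀ i ∈ Finset.range n, extendOne (fun _ : Fin (n - 1) ↦ Multiplicative.ofAdd (1 : ℕ)) i
      ^ (n - 1 - i) = Multiplicative.ofAdd (n - 1 - i) := by
    intro i _
    rcases Nat.lt_or_ge i (n - 1) with hi | hi
    · rw [extendOne_of_lt _ hi, ← ofAdd_nsmul, smul_eq_mul, mul_one]
    · rw [Nat.sub_eq_zero_of_le hi, pow_zero, ofAdd_zero]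
  rw [Finset.prod_congr rfl h', ← ofAdd_nsmul, smul_eq_mul, mul_one, ← ofAdd_sum] at h
  rw [Multiplicative.ofAdd.injective h, Finset.sum_range_reflect (fun i ↦ i), Finset.sum_range_id]

theorem simple_apply_val (r : Fin (n - 1)) (i : Fin n) :
    (simple r i : ℕ) = if i.1 = r.1 then r.1 + 1 else if i.1 = r.1 + 1 then r.1 else i.1 := by
  simp only [simple, Equiv.swap_apply_def, Fin.ext_iff, lo, hi]
  split_ifs <;> rfl

/-- This is the cycle carrying `0` to `m` and lowering the letters between; composing these cycles
gives the reversal in `stair_simple_apply`. -/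
theorem desc_simple_apply {m : ℕ} (hm : m < n) (i : Fin n) :
    (desc (extendOne (simple (n := n))) m i : ℕ) =
      if i.1 = 0 then m else if i.1 ≤ m then i.1 - 1 else i.1 := by
  induction m with
  | zero =>
    rw [desc, Equiv.Perm.one_apply]
    split_ifs <;> omega
  | succ m ih =>
    rw [desc, Equiv.Perm.mul_apply, extendOne_of_lt _ (show m < n - 1 by omega), simple_apply_val,
      ih (by omega)]
    dsimp only
    split_ifs <;> omega

theorem stair_simple_apply {m : ℕ} (hm : m ≤ n) (i : Fin n) :
    (stair (extendOne (simple (n := n))) m i : ℕ) = if i.1 < m then m - 1 - i.1 else i.1 := by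
  induction m generalizing i with
  | zero => simp [stair]
  | succ m ih =>
    rw [stair, Equiv.Perm.mul_apply, ih (by omega), desc_simple_apply (by omega)]
    split_ifs <;> omega

theorem wordProd_stairWord : wordProd (stairWord n) = longest n := by
  rw [wordProd, prod_map_stairWord]
  ext i
  rw [stair_simple_apply le_rfl, if_pos i.2, longest, Fin.revPerm_apply, Fin.val_rev]
  omega

theorem length_stairWord_eq_inv : (stairWord n).length = inv (wordProd (stairWord n)) := by
  rw [wordProd_stairWord, length_stairWord, inv_longest]

end StairWord

/-! ### The cyclotomic nilHecke algebra -/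

section Cyclotomic

variable {K : Type*} [Field K] {ℓ n : ℕ}

theorem psi_sq (r : Fin (n - 1)) : psi (K := K) ℓ r * psi ℓ r = 0 := by
  simpa [psi] using mk_rel ℓ (Rel.psi_sq (K := K) r)

theorem psi_comm (r k : Fin (n - 1)) (h : k.1 + 1 < r.1) :
    psi (K := K) ℓ r * psi ℓ k = psi ℓ k * psi ℓ r := by
  simpa [psi] using mk_rel ℓ (Rel.psi_comm (K := K) r k h)

theorem psi_braid (r r' : Fin (n - 1)) (h : r'.1 = r.1 + 1) :
    psi (K := K) ℓ r * psi ℓ r' * psi ℓ r = psi ℓ r' * psi ℓ r * psi ℓ r' := by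
  simpa [psi] using mk_rel ℓ (Rel.braid (K := K) r r' h)

theorem nilRel (K : Type*) [Field K] (ℓ n : ℕ) :
    NilRel n (extendOne (psi (K := K) ℓ (n := n))) (extendOne (y (K := K) ℓ (n := n))) where
  sq r hr := by
    rw [extendOne_of_lt _ (show r < n - 1 by omega), psi_sq]
  comm r k h hk := by
    rw [extendOne_of_lt _ (show r < n - 1 by omega), extendOne_of_lt _ (show k < n - 1 by omega),
      psi_comm (⟨k, by omega⟩ : Fin (n - 1)) ⟨r, by omega⟩ h]
  braid r hr := by
    rw [extendOne_of_lt _ (show r < n - 1 by omega),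
      extendOne_of_lt _ (show r + 1 < n - 1 by omega), psi_braid _ _ rfl]
  y_comm r k hr hk := by
    rw [extendOne_of_lt _ hr, extendOne_of_lt _ hk]
    simpa [y] using mk_rel ℓ (Rel.y_comm (K := K) ⟨r, hr⟩ ⟨k, hk⟩)
  psi_y_comm r k hr hk h₁ h₂ := by
    rw [extendOne_of_lt _ (show r < n - 1 by omega), extendOne_of_lt _ hk]
    simpa [psi, y] using mk_rel ℓ (Rel.psi_y_comm (K := K) ⟨r, by omega⟩ ⟨k, hk⟩
      (fun h ↦ h₁ (Fin.ext_iff.1 h)) (fun h ↦ h₂ (Fin.ext_iff.1 h)))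
  psi_y r hr := by
    rw [extendOne_of_lt _ (show r < n - 1 by omega), extendOne_of_lt _ hr,
      extendOne_of_lt _ (show r < n by omega)]
    simpa [psi, y, lo, hi] using mk_rel ℓ (Rel.psi_y (K := K) (n := n) ⟨r, by omega⟩)
  y_psi r hr := by
    rw [extendOne_of_lt _ (show r < n - 1 by omega), extendOne_of_lt _ hr,
      extendOne_of_lt _ (show r < n by omega)]
    simpa [psi, y, lo, hi] using mk_rel ℓ (Rel.y_psi (K := K) (n := n) ⟨r, by omega⟩)

/-- The cyclotomic nilHecke algebra is generated by the `ψ_r` and the `y_k`. -/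
theorem cyc_induction {P : Cyc K ℓ n → Prop} (algebraMap : ∀ c, P (algebraMap K _ c))
    (psi : ∀ r, P (psi ℓ r)) (y : ∀ k, P (y ℓ k)) (mul : ∀ a b, P a → P b → P (a * b))
    (add : ∀ a b, P a → P b → P (a + b)) (x : Cyc K ℓ n) : P x := by
  obtain ⟨x, rfl⟩ := RingQuot.mkAlgHom_surjective K (CycRel K ℓ n) x
  obtain ⟨x, rfl⟩ := RingQuot.mkAlgHom_surjective K (Rel K n) x
  change P (mkCyc K ℓ n (mkAffine K n x))
  induction x using FreeAlgebra.induction with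
  | grade0 c =>
    rw [AlgHom.commutes, AlgHom.commutes]
    exact algebraMap c
  | grade1 i => exact Sum.rec psi y i
  | mul a b ha hb =>
    rw [map_mul, map_mul]
    exact mul _ _ ha hb
  | add a b ha hb =>
    rw [map_add, map_add]
    exact add _ _ ha hb

/-! ### The anti-automorphism and the products `ψ_u ψ_{w_0 v}^*` -/

theorem anti_add (x x' : Cyc K ℓ n) : anti (x + x') = anti x + anti x' := by
  simp [anti]

theorem anti_algebraMap (c : K) : anti (algebraMap K (Cyc K ℓ n) c) = algebraMap K _ c := by
  simp [anti]

theorem anti_one : anti (1 : Cyc K ℓ n) = 1 := by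
  simp [anti]

theorem anti_prod_map_psi (l : List (Fin (n - 1))) :
    anti ((l.map (psi (K := K) ℓ)).prod) = (l.reverse.map (psi ℓ)).prod := by
  induction l with
  | nil => exact anti_one
  | cons r l ih => simp [anti_mul, anti_psi, ih]

theorem prod_map_psi_eq {l l' : List (Fin (n - 1))} (hl : l.length = inv (wordProd l))
    (hl' : l'.length = inv (wordProd l')) (h : wordProd l = wordProd l') :
    (l.map (psi (K := K) ℓ)).prod = (l'.map (psi ℓ)).prod :=
  prod_map_eq_of_reduced psi_comm psi_braid l l' hl hl' h

theorem prod_map_psi_of_longest {l : List (Fin (n - 1))} (hl : l.length = inv (longest n))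
    (h : wordProd l = longest n) :
    (l.map (psi (K := K) ℓ)).prod = stair (extendOne (psi ℓ)) n := by
  rw [prod_map_psi_eq (by rw [hl, h]) length_stairWord_eq_inv (by rw [h, wordProd_stairWord]),
    prod_map_stairWord]

theorem psiPerm_longest : psiPerm K ℓ (longest n) = stair (extendOne (psi ℓ)) n :=
  prod_map_psi_of_longest (length_reducedWord _) (wordProd_reducedWord _)

theorem psiPerm_one : psiPerm K ℓ (1 : Equiv.Perm (Fin n)) = 1 := by
  have : reducedWord (1 : Equiv.Perm (Fin n)) = [] := by
    rw [← List.length_eq_zero_iff, length_reducedWord, inv_one]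
  rw [psiPerm, this]
  rfl

/-- `w_0` is an involution, so a reversed reduced word of it is again one. -/
theorem anti_stair : anti (stair (extendOne (psi (K := K) ℓ (n := n))) n) =
    stair (extendOne (psi ℓ)) n := by
  rw [← psiPerm_longest, psiPerm, anti_prod_map_psi, ← psiPerm, psiPerm_longest]
  refine prod_map_psi_of_longest ?_ ?_
  · rw [List.length_reverse, length_reducedWord]
  · rw [wordProd_reverse, wordProd_reducedWord, longest_inv]

theorem psiPerm_mul_anti (u v : Equiv.Perm (Fin n)) :
    psiPerm K ℓ u * anti (psiPerm K ℓ (longest n * v)) =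
      ((reducedWord u ++ (reducedWord (longest n * v)).reverse).map (psi ℓ)).prod := by
  rw [psiPerm, psiPerm, anti_prod_map_psi, List.map_append, List.prod_append]

theorem psiPerm_mul_anti_self (u : Equiv.Perm (Fin n)) :
    psiPerm K ℓ u * anti (psiPerm K ℓ (longest n * u)) = stair (extendOne (psi ℓ)) n := by
  rw [psiPerm_mul_anti]
  refine prod_map_psi_of_longest ?_ ?_
  · rw [List.length_append, List.length_reverse, length_reducedWord, length_reducedWord, add_comm,
      inv_longest_mul]
  · rw [wordProd_append, wordProd_reverse, wordProd_reducedWord, wordProd_reducedWord, mul_inv_rev,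
      longest_inv, mul_inv_cancel_left]

/-- If the concatenated word were reduced, complementing lengths in `w_0` would give `inv v = inv u
+ inv (u v⁻¹)`. A reduced word of `u⁻¹` would then extend to one of `v⁻¹ = u⁻¹ (u v⁻¹)`. -/
theorem psiPerm_mul_anti_of_not_weakGE {u v : Equiv.Perm (Fin n)} (h : ¬ WeakGE u⁻¹ v⁻¹) :
    psiPerm K ℓ u * anti (psiPerm K ℓ (longest n * v)) = 0 := by
  rw [psiPerm_mul_anti]
  refine prod_map_eq_zero psi_sq psi_comm psi_braid _ fun hlen ↦ h ?_
  rw [List.length_append, List.length_reverse, length_reducedWord, length_reducedWord,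
    wordProd_append, wordProd_reverse, wordProd_reducedWord, wordProd_reducedWord, mul_inv_rev,
    longest_inv, ← mul_assoc] at hlen
  have h1 := inv_longest_mul v
  have h2 := inv_mul_longest (u * v⁻¹)
  obtain ⟨l, hl, hlen'⟩ := exists_word_length_eq_inv (u * v⁻¹)
  have hp : wordProd ((reducedWord u).reverse ++ l) = v⁻¹ := by
    rw [wordProd_append, wordProd_reverse, wordProd_reducedWord, hl, inv_mul_cancel_left]
  refine ⟨(reducedWord u).reverse ++ l, isReduced_iff.2 ?_, hp, (reducedWord u).reverse,
    List.prefix_append _ _, by rw [wordProd_reverse, wordProd_reducedWord]⟩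
  rw [hp, List.length_append, List.length_reverse, length_reducedWord, hlen', inv_inv]
  omega

/-! ### Polynomials, the left ideal of `ψ_{w_0}` and its corner -/

variable {Φ : MvPolynomial (Fin n) K →ₐ[K] Cyc K ℓ n}

theorem yStair_eq_map (hΦ : ∀ k : Fin n, Φ (MvPolynomial.X k) = y ℓ k) :
    yStair K ℓ n = Φ (∏ k : Fin n, MvPolynomial.X k ^ (n - 1 - k.1)) := by
  rw [← List.prod_ofFn, map_list_prod, List.map_ofFn, yStair]
  congr 2
  funext k
  simp [hΦ]

theorem yStair_eq_stair (hΦ : ∀ k : Fin n, Φ (MvPolynomial.X k) = y ℓ k) :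
    yStair K ℓ n = stair (extendOne (y ℓ)) n := by
  have h : (fun i ↦ (Φ : MvPolynomial (Fin n) K →* Cyc K ℓ n)
      (extendOne (MvPolynomial.X (R := K)) i)) =
      extendOne (y ℓ (n := n)) := by
    funext i
    rw [map_extendOne]
    congr 1
    funext k
    exact hΦ k
  rw [yStair_eq_map hΦ, ← h, ← map_stair, stair_eq_prod, Finset.prod_range]
  simp only [extendOne_val]
  rfl

theorem anti_polynomial (hΦ : ∀ k : Fin n, Φ (MvPolynomial.X k) = y ℓ k)
    (f : MvPolynomial (Fin n) K) : anti (Φ f) = Φ f := by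
  induction f using MvPolynomial.induction_on with
  | C c =>
    rw [← MvPolynomial.algebraMap_eq, AlgHom.commutes]
    exact anti_algebraMap c
  | add f g hf hg => rw [map_add, anti_add, hf, hg]
  | mul_X f k hf =>
    rw [map_mul, anti_mul, hf, hΦ, anti_y, ← hΦ, ← map_mul, ← map_mul, mul_comm]

/-- Only the divided difference survives when `ψ_r` moves past a polynomial and meets `ψ_{w_0}`. The
factor `Φ f` makes the induction close under products. -/
theorem exists_polynomial_mul_stair (hΦ : ∀ k : Fin n, Φ (MvPolynomial.X k) = y ℓ k)
    (h : Cyc K ℓ n) (f : MvPolynomial (Fin n) K) :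
    ∃ g, h * Φ f * stair (extendOne (psi ℓ)) n = Φ g * stair (extendOne (psi ℓ)) n := by
  induction h using cyc_induction generalizing f with
  | algebraMap c => exact ⟨algebraMap K _ c * f, by rw [map_mul, AlgHom.commutes]⟩
  | psi r =>
    have := (nilRel K ℓ n).exists_psi_mul_polynomial_mul
      (fun k ↦ (hΦ k).trans (extendOne_val _ k).symm) r f
    rwa [extendOne_val] at this
  | y k => exact ⟨MvPolynomial.X k * f, by rw [map_mul, hΦ]⟩
  | mul a b ha hb =>
    obtain ⟨g, hg⟩ := hb f
    obtain ⟨g', hg'⟩ := ha g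
    exact ⟨g', by rw [← hg', mul_assoc a b, mul_assoc a, hg, ← mul_assoc]⟩
  | add a b ha hb =>
    obtain ⟨g, hg⟩ := ha f
    obtain ⟨g', hg'⟩ := hb f
    exact ⟨g + g', by rw [map_add, add_mul, add_mul, add_mul, hg, hg']⟩

theorem commute_of_isSymmetric (hΦ : ∀ k : Fin n, Φ (MvPolynomial.X k) = y ℓ k)
    {f : MvPolynomial (Fin n) K} (hf : f.IsSymmetric) (h : Cyc K ℓ n) : Commute (Φ f) h := by
  induction h using cyc_induction with
  | algebraMap c => exact (Algebra.commutes c _).symm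
  | psi r =>
    have := (nilRel K ℓ n).commute_psi_of_isSymmetric
      (fun k ↦ (hΦ k).trans (extendOne_val _ k).symm) r hf
    rw [extendOne_val] at this
    exact this.symm
  | y k =>
    rw [← hΦ]
    exact (Commute.all f _).map Φ
  | mul a b ha hb => exact ha.mul_right hb
  | add a b ha hb => exact ha.add_right hb

/-- The anti-automorphism fixes the elements of `ψ_{w_0} H ψ_{w_0}`. -/
theorem anti_stair_mul_stair (hΦ : ∀ k : Fin n, Φ (MvPolynomial.X k) = y ℓ k) (h : Cyc K ℓ n) :
    anti (stair (extendOne (psi ℓ)) n * h * stair (extendOne (psi ℓ)) n) =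
      stair (extendOne (psi ℓ)) n * h * stair (extendOne (psi ℓ)) n := by
  obtain ⟨g, hg⟩ := exists_polynomial_mul_stair hΦ h 1
  rw [map_one, mul_one] at hg
  rw [mul_assoc, hg, anti_mul, anti_mul, anti_stair, anti_polynomial hΦ, mul_assoc]

/-- Gelfand's trick: for `a, b` in `p H p` the element `a t b` also lies there, so `a t b = (a t
b)^* = b t a`. -/
theorem stair_mul_comm (hΦ : ∀ k : Fin n, Φ (MvPolynomial.X k) = y ℓ k) (h h' : Cyc K ℓ n) :
    (stair (extendOne (psi ℓ)) n * h * stair (extendOne (psi ℓ)) n) * yStair K ℓ n *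
        (stair (extendOne (psi ℓ)) n * h' * stair (extendOne (psi ℓ)) n) =
      (stair (extendOne (psi ℓ)) n * h' * stair (extendOne (psi ℓ)) n) * yStair K ℓ n *
        (stair (extendOne (psi ℓ)) n * h * stair (extendOne (psi ℓ)) n) := by
  have h1 := anti_stair_mul_stair hΦ
    (h * stair (extendOne (psi ℓ)) n * yStair K ℓ n * stair (extendOne (psi ℓ)) n * h')
  have h2 : ∀ a b : Cyc K ℓ n, stair (extendOne (psi ℓ)) n *
      (a * stair (extendOne (psi ℓ)) n * yStair K ℓ n * stair (extendOne (psi ℓ)) n * b) *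
        stair (extendOne (psi ℓ)) n =
      (stair (extendOne (psi ℓ)) n * a * stair (extendOne (psi ℓ)) n) * yStair K ℓ n *
        (stair (extendOne (psi ℓ)) n * b * stair (extendOne (psi ℓ)) n) := by
    intro a b
    simp only [mul_assoc]
  have e := anti_stair_mul_stair hΦ h
  have e' := anti_stair_mul_stair hΦ h'
  rw [h2] at h1
  generalize stair (extendOne (psi ℓ)) n * h * stair (extendOne (psi ℓ)) n = a at *
  generalize stair (extendOne (psi ℓ)) n * h' * stair (extendOne (psi ℓ)) n = b at *
  rw [anti_mul, anti_mul, e, e'] at h1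
  rw [← h1, yStair_eq_map hΦ, anti_polynomial hΦ, ← mul_assoc]

theorem fUnit_eq (w : Fin (n !) ≃ Equiv.Perm (Fin n)) (i j : Fin (n !)) :
    fUnit K ℓ w i j = FPrime K ℓ (w i) (w j) -
      ∑ k : {k : Fin (n !) // k < i}, fUnit K ℓ w k.1 k.1 * FPrime K ℓ (w i) (w j) := by
  rw [fUnit]

theorem fUnit_first {w : Fin (n !) ≃ Equiv.Perm (Fin n)} (hw : IsAdmissible w) :
    fUnit K ℓ w ⟨0, Nat.factorial_pos n⟩ ⟨0, Nat.factorial_pos n⟩ =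
      stair (extendOne (psi ℓ)) n * yStair K ℓ n * stair (extendOne (psi ℓ)) n * yStair K ℓ n := by
  have : IsEmpty {k : Fin (n !) // k < ⟨0, Nat.factorial_pos n⟩} :=
    ⟨fun k ↦ absurd k.2 (Nat.not_lt_zero _)⟩
  rw [fUnit_eq, Finset.univ_eq_empty, Finset.sum_empty, sub_zero, hw.first, FPrime, mul_one,
    psiPerm_one, mul_one, psiPerm_longest, anti_stair]

end Cyclotomic

end NilHecke

/-! ### Assembly of the isomorphisms -/

open NilHecke in
theorem mainTheorem3 {K : Type*} [Field K] (ℓ n : ℕ) (hℓ : n ≤ ℓ)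
    (w : Fin (n !) ≃ Equiv.Perm (Fin n)) (hw : NilHecke.IsAdmissible w) :
    (∃ η : (Matrix (Fin (n !)) (Fin (n !)) K ⊗[K] Subalgebra.center K (NilHecke.Cyc K ℓ n)) ≃ₐ[K]
        NilHecke.Cyc K ℓ n,
      ∀ (i j : Fin (n !)) (z : Subalgebra.center K (NilHecke.Cyc K ℓ n)),
        η (Matrix.single i j (1 : K) ⊗ₜ[K] z) =
          NilHecke.fUnit K ℓ w i j * (z : NilHecke.Cyc K ℓ n)) ∧
    (∃ θ : NilHecke.Cyc K ℓ n ≃ₐ[K]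
        Matrix (Fin (n !)) (Fin (n !)) (Subalgebra.center K (NilHecke.Cyc K ℓ n)),
      ∀ z : Subalgebra.center K (NilHecke.Cyc K ℓ n),
        θ (z : NilHecke.Cyc K ℓ n) = Matrix.scalar (Fin (n !)) z) := by
  obtain ⟨Φ, hΦ'⟩ := (nilRel K ℓ n).exists_polynomial_map (K := K)
  have hΦ : ∀ k : Fin n, Φ (MvPolynomial.X k) = y ℓ k :=
    fun k ↦ (hΦ' k).trans (extendOne_val _ k)
  let o : Fin (n !) := ⟨0, Nat.factorial_pos n⟩
  let p : Cyc K ℓ n := stair (extendOne (psi ℓ)) n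
  let t : Cyc K ℓ n := yStair K ℓ n
  have hp : p * t * p * t * p = p := by
    simp only [p, t]
    rw [yStair_eq_stair hΦ]
    exact (nilRel K ℓ n).stair_sandwich
  have ho : fUnit K ℓ w o o = p * t * p * t := fUnit_first hw
  have hf := mul_eq_of_unitriangular (p := p) (t := t) (f := fUnit K ℓ w)
    (a := fun i ↦ anti (psiPerm K ℓ (longest n * w i))) (b := fun j ↦ psiPerm K ℓ (w j))
    (fun i ↦ by
      rw [mul_assoc (p * t), psiPerm_mul_anti_self]
      exact hp)
    (fun i j hij ↦ by
      rw [mul_assoc (p * t), psiPerm_mul_anti_of_not_weakGE, mul_zero, zero_mul, zero_mul]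
      intro h
      exact hij.not_gt (hw.lt_of_weakGT j i
        ⟨h, fun h' ↦ hij.ne (w.injective (inv_injective h'.symm))⟩))
    (fun i j ↦ by
      rw [fUnit_eq, FPrime, psiPerm_longest])
  have hcomm : ∀ x x', fUnit K ℓ w o o * x * fUnit K ℓ w o o *
      (fUnit K ℓ w o o * x' * fUnit K ℓ w o o) =
      fUnit K ℓ w o o * x' * fUnit K ℓ w o o * (fUnit K ℓ w o o * x * fUnit K ℓ w o o) := by
    -- As `e = p t p t` and `p t p t p = p`, the product in the corner takes the form `p t (a t b) t
    -- p t` with `a, b` in `p H p`.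
    have h1 : ∀ x x', fUnit K ℓ w o o * x * fUnit K ℓ w o o *
        (fUnit K ℓ w o o * x' * fUnit K ℓ w o o) =
          p * t * (p * (t * x) * p * t * (p * (t * x') * p)) * (t * p * t) := by
      intro x x'
      rw [ho]
      calc _ = p * t * p * t * x * (p * t * p * t * p) * t * p * t * x' * p * t * p * t := by
            simp only [mul_assoc]
        _ = _ := by rw [hp]; simp only [mul_assoc]
    intro x x'
    rw [h1, h1, stair_mul_comm hΦ]
  have hone : ∑ i, fUnit K ℓ w i i = 1 := by
    obtain ⟨m, hm⟩ := exists_symmetric_span K n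
    refine sum_eq_one_of_span hf o hcomm (fun i ↦ Φ (m i)) (fun h ↦ ?_) (fun d hd ↦ ?_)
    · obtain ⟨g, hg⟩ := exists_polynomial_mul_stair hΦ h 1
      obtain ⟨s, hs, hsum⟩ := hm g
      refine ⟨fun i ↦ Φ (s i), fun i x ↦ commute_of_isSymmetric hΦ (hs i) x, ?_⟩
      rw [map_one, mul_one] at hg
      have h1 : h * fUnit K ℓ w o o = Φ g * fUnit K ℓ w o o := by
        rw [ho]
        simp only [← mul_assoc]
        rw [hg]
      rw [h1, hsum, map_sum, Finset.sum_mul]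
      refine Finset.sum_congr rfl fun i _ ↦ ?_
      rw [map_mul, mul_assoc]
      exact commute_of_isSymmetric hΦ (hs i) _
    · refine (nilRel K ℓ n).eq_zero_of_forall_mul_stair le_rfl fun h ↦ ?_
      change d * h * p = 0
      -- Since `e p = p`, annihilating `H e` from the left implies annihilating `H p`.
      rw [← hp, ← ho, ← mul_assoc, hd, zero_mul]
  obtain ⟨e, he, hscalar⟩ := exists_matrix_algEquiv (K := K) hf hone o hcomm
  refine ⟨⟨((Algebra.TensorProduct.comm K _ _).trans
    (matrixEquivTensor (Fin (n !)) K (Subalgebra.center K (Cyc K ℓ n))).symm).trans e,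
    fun i j z ↦ ?_⟩, e.symm, fun z ↦ ?_⟩
  · have h1 : (matrixEquivTensor (Fin (n !)) K (Subalgebra.center K (Cyc K ℓ n))).symm
        (z ⊗ₜ[K] Matrix.single i j (1 : K)) = Matrix.single i j z := by
      rw [AlgEquiv.symm_apply_eq, matrixEquivTensor_apply_single]
    rw [AlgEquiv.trans_apply, AlgEquiv.trans_apply, Algebra.TensorProduct.comm_tmul, h1, he,
      Finset.sum_eq_single i, Finset.sum_eq_single j, Matrix.single_apply_same]
    · intro b _ hb
      rw [Matrix.single_apply_of_col_ne _ _ hb.symm, ZeroMemClass.coe_zero, mul_zero]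
    · simp
    · intro a _ ha
      refine Finset.sum_eq_zero fun b _ ↦ ?_
      rw [Matrix.single_apply_of_row_ne ha.symm, ZeroMemClass.coe_zero, mul_zero]
    · simp
  · rw [AlgEquiv.symm_apply_eq, hscalar]
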